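/- Let $\Omega\subset\mathbb R^n$ be a bounded domain, $T>0$, $\varepsilon>0$, $\alpha\in[0,1]$ and $\beta=1-\alpha$ (in particular $\alpha=\frac{p-2}{p+n}$, $\beta=\frac{n+2}{p+n}$ with $2\le p<\infty$). Put $\Omega_T=\Omega\times(0,T)$, $S_\varepsilon=\{x\in\mathbb R^n\setminus\Omega:\operatorname{dist}(x,\partial\Omega)\le\varepsilon\}$ and $$\Gamma_p^\varepsilon=\bigl(S_\varepsilon\times(-\tfrac{\varepsilon^2}{2},T]\bigr)\cup\bigl(\Omega\times(-\tfrac{\varepsilon^2}{2},0]\bigr),$$ and let $B_\varepsilon(x)$ be the open ball. Let $F:\Gamma_p^\varepsilon\to\mathbb R$ and $\psi:\mathbb R^{n+1}\to\mathbb R$ satisfy, for some constants $C_1,C_2$, $$|F(x,t)-F(y,s)|\le C_1(|x-y|+|t-s|^{1/2}),\qquad |\psi(x,t)-\psi(y,s)|\le C_2(|x-y|+|t-s|^{1/2}),$$ and $\psi\le F$ on $\Gamma_p^\varepsilon$. **The game.** For a starting point $(x_0,t_0)\in\Omega_T\cup\Gamma_p^\varepsilon$ let $N$ be the integer with $\frac{2t_0}{\varepsilon^2}\le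 N<\frac{2t_0}{\varepsilon^2}+1$ if $t_0>0$, and $N=0$ if $t_0\le0$; let $t_k=t_0-k\frac{\varepsilon^2}{2}$. A strategy $\sigma_I$ of player I (respectively $\sigma_{II}$ of player II) assigns, in a Borel way, to each history $(x_0,\dots,x_k)$ a point $\sigma^k(x_0,\dots,x_k)\in B_\varepsilon(x_k)$. Player I also chooses a stopping time $\tau$ with respect to the filtration generated by the positions $x_0,x_1,\dots$, with $\tau\le\min\{N,\inf\{k:x_k\in S_\varepsilon\}\}$. These data determine a law $\mathbb P^{x_0,N}_{\tau,\sigma_I,\sigma_{II}}$ of the run $(x_0,x_1,\dots)$ with initial distribution $\delta_{x_0}$ and transition probabilities $$\pi_k(x_0,\dots,x_k)(A)=\begin{cases}\frac{\alpha}{2}\bigl(\delta_{\sigma_I^k(x_0,\dots,x_k)}(A)+\delta_{\sigma_{II}^k(x_0,\dots,x_k)}(A)\bigr)+\beta\,\frac{|A\cap B_\varepsilon(x_k)|}{|B_\varepsilon(x_k)|},&k<\tau,\\ \delta_{x_k}(A),&\text{otherwise.}\end{cases}$$ Let $G=F$ on $\Gamma_p^\varepsilon$ and $G=\psi$ on $\Omega_T$,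 and define $$u_I(x_0,t_0)=\sup_{\tau,\sigma_I}\inf_{\sigma_{II}}\mathbb E^{x_0,N}_{\tau,\sigma_I,\sigma_{II}}[G(x_\tau,t_\tau)],\qquad u_{II}(x_0,t_0)=\inf_{\sigma_{II}}\sup_{\tau,\sigma_I}\mathbb E^{x_0,N}_{\tau,\sigma_I,\sigma_{II}}[G(x_\tau,t_\tau)].$$ **Theorem.** There is exactly one bounded Borel function $u^\varepsilon:\Omega_T\cup\Gamma_p^\varepsilon\to\mathbb R$ that satisfies the dynamic programming principle $$u^\varepsilon(x,t)=\max\Bigl\{\psi(x,t),\ \tfrac{\alpha}{2}\Bigl(\sup_{y\in B_\varepsilon(x)}u^\varepsilon(y,t-\tfrac{\varepsilon^2}{2})+\inf_{y\in B_\varepsilon(x)}u^\varepsilon(y,t-\tfrac{\varepsilon^2}{2})\Bigr)+\beta\,\frac{1}{|B_\varepsilon(x)|}\int_{B_\varepsilon(x)}u^\varepsilon(y,t-\tfrac{\varepsilon^2}{2})\,dy\Bigr\}$$ for $(x,t)\in\Omega_T$, and $u^\varepsilon=F$ on $\Gamma_p^\varepsilon$. Moreover $$u_I=u_{II}=u^\varepsilon\qquad\text{on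 }\Omega_T\cup\Gamma_p^\varepsilon .$$ So the game has a value, and this value satisfies the dynamic programming principle. -/

import Mathlib

open MeasureTheory ProbabilityTheory

namespace TugOfWar

/-- `ℝⁿ` with the Euclidean norm. -/
abbrev E (n : ℕ) : Type := EuclideanSpace ℝ (Fin n)

/-- The open parabolic cylinder `Ω_T = Ω × (0, T)`. -/
def cylinder {n : ℕ} (Ω : Set (E n)) (T : ℝ) : Set (E n × ℝ) :=
  Ω ×ˢ Set.Ioo 0 T

/-- The outer strip `S_ε` of points outside `Ω` at distance at most `ε` from `∂Ω`. -/
def outerStrip {n : ℕ} (Ω : Set (E n)) (ε : ℝ) : Set (E n) :=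
  {x | x ∉ Ω ∧ Metric.infDist x (frontier Ω) ≤ ε}

/-- The parabolic boundary strip
`Γ_p^ε = S_ε × (-ε²/2, T] ∪ Ω × (-ε²/2, 0]`. -/
def boundaryStrip {n : ℕ} (Ω : Set (E n)) (T ε : ℝ) : Set (E n × ℝ) :=
  outerStrip Ω ε ×ˢ Set.Ioc (-(ε ^ 2 / 2)) T ∪ Ω ×ˢ Set.Ioc (-(ε ^ 2 / 2)) 0

/-- The set `Ω_T ∪ Γ_p^ε` on which solutions of the dynamic programming principle live. -/
def extendedCylinder {n : ℕ} (Ω : Set (E n)) (T ε : ℝ) : Set (E n × ℝ) :=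
  cylinder Ω T ∪ boundaryStrip Ω T ε

/-- `f` is Lipschitz on `A` with constant `C` for the parabolic distance
`|x - y| + |t - s|^{1/2}`. -/
def ParabolicLipschitzOn {n : ℕ} (C : ℝ) (f : E n × ℝ → ℝ) (A : Set (E n × ℝ)) : Prop :=
  ∀ z ∈ A, ∀ w ∈ A, |f z - f w| ≤ C * (‖z.1 - w.1‖ + √|z.2 - w.2|)

/-- `u` is a bounded Borel function on `Ω_T ∪ Γ_p^ε` that satisfies the dynamic programming
principle with boundary data `F` and obstacle `ψ`; the weights are `α` and `β = 1 - α`.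
Values of `u` outside `Ω_T ∪ Γ_p^ε` play no role: `B_ε(x) ⊆ Ω ∪ S_ε` for every `x ∈ Ω`. -/
structure IsDPPSolution {n : ℕ} (Ω : Set (E n)) (T ε : ℝ) (α : Set.Icc (0 : ℝ) 1)
    (F ψ u : E n × ℝ → ℝ) : Prop where
  borel : Measurable ((extendedCylinder Ω T ε).domRestrict u)
  bounded : ∃ M : ℝ, ∀ z ∈ extendedCylinder Ω T ε, |u z| ≤ M
  interior_eq : ∀ x ∈ Ω, ∀ t ∈ Set.Ioo 0 T,
    u (x, t) = max (ψ (x, t))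
      ((α : ℝ) / 2 * ((⨆ y : Metric.ball x ε, u (y, t - ε ^ 2 / 2)) +
          (⨅ y : Metric.ball x ε, u (y, t - ε ^ 2 / 2))) +
        (1 - (α : ℝ)) * ⨍ y in Metric.ball x ε, u (y, t - ε ^ 2 / 2))
  boundary_eq : ∀ z ∈ boundaryStrip Ω T ε, u z = F z

/-- The history `(x₀, …, x_k)` of the positions of the token up to step `k`. -/
abbrev History (n k : ℕ) : Type := (_ : Finset.Iic k) → E n

/-- The current position `x_k` of a history `(x₀, …, x_k)`. -/
def History.last {n k : ℕ} (h : History n k) : E n := h ⟨k, Finset.mem_Iic.2 le_rfl⟩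

/-- A (Borel) strategy with step size `ε`: for every history `(x₀, …, x_k)` a choice of the next
position in the open ball `B_ε(x_k)`. -/
structure Strategy (n : ℕ) (ε : ℝ) where
  move : (k : ℕ) → History n k → E n
  measurable_move : ∀ k, Measurable (move k)
  move_mem : ∀ k h, move k h ∈ Metric.ball h.last ε

/-- The maximal length of the game `min {N, inf {k | x_k ∈ S_ε}}` along a run `x`. -/
noncomputable def maxLength {n : ℕ} (Ω : Set (E n)) (ε : ℝ) (N : ℕ) (x : ℕ → E n) : ℕ :=
  sInf {k | k = N ∨ x k ∈ outerStrip Ω ε}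

/-- A stopping rule of player I: a stopping time, for the filtration generated by the positions
of the token, that is at most the maximal length of the game. -/
structure StoppingRule {n : ℕ} (Ω : Set (E n)) (ε : ℝ) (N : ℕ) where
  time : (ℕ → E n) → ℕ
  isStoppingTime :
    IsStoppingTime (Filtration.piLE (X := fun _ : ℕ => E n)) (fun x => (time x : WithTop ℕ))
  time_le : ∀ x, time x ≤ maxLength Ω ε N x

/-- The run that follows the history `h` and then stays at its last position. -/
def History.extend {n k : ℕ} (h : History n k) : ℕ → E n :=
  fun i => h ⟨min i k, Finset.mem_Iic.2 (min_le_right i k)⟩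

/-- The game goes on after the history `h = (x₀, …, x_k)`, i.e. `k < τ`. As `τ` is a stopping
time, whether this holds for a run depends only on its positions up to step `k`. -/
def StoppingRule.Continues {n N k : ℕ} {Ω : Set (E n)} {ε : ℝ} (τ : StoppingRule Ω ε N)
    (h : History n k) : Prop :=
  k < τ.time h.extend

open Classical in
/-- The transition probability `π_k(x₀, …, x_k)`: while `k < τ`, with probability `α / 2` each the
token moves as player I, respectively II, wishes, and with probability `β = 1 - α` it moves
uniformly at random in `B_ε(x_k)`; from the stopping time on, it stays where it is. -/
noncomputable def transition {n N : ℕ} {Ω : Set (E n)} {ε : ℝ} (α : Set.Icc (0 : ℝ) 1)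
    (τ : StoppingRule Ω ε N) (σI σII : Strategy n ε) (k : ℕ) (h : History n k) :
    Measure (E n) :=
  if τ.Continues h then
    ENNReal.ofReal ((α : ℝ) / 2) • (Measure.dirac (σI.move k h) + Measure.dirac (σII.move k h)) +
      ENNReal.ofReal (1 - (α : ℝ)) • cond volume (Metric.ball h.last ε)
  else Measure.dirac h.last

lemma measurable_last {n k : ℕ} : Measurable (History.last : History n k → E n) :=
  measurable_pi_apply _

lemma measurable_uniform (n : ℕ) (ε : ℝ) :
    Measurable (fun x : E n => cond (volume : Measure (E n)) (Metric.ball x ε)) := by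
  have key : ∀ s : Set (E n), MeasurableSet s →
      Measurable fun x : E n => volume (Metric.ball x ε ∩ s) := by
    intro s hs
    have hm : MeasurableSet {q : E n × E n | dist q.2 q.1 < ε ∧ q.2 ∈ s} :=
      (measurableSet_lt (measurable_snd.dist measurable_fst) measurable_const).inter
        (measurable_snd hs)
    exact measurable_measure_prodMk_left hm
  refine Measure.measurable_of_measurable_coe _ fun s hs => ?_
  simp only [cond_apply measurableSet_ball]
  have h1 := key Set.univ MeasurableSet.univ
  simp only [Set.inter_univ] at h1
  exact h1.inv.mul (key s hs)

lemma StoppingRule.measurableSet_continues {n N k : ℕ} {Ω : Set (E n)} {ε : ℝ}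
    (τ : StoppingRule Ω ε N) : MeasurableSet {h : History n k | τ.Continues h} := by
  have h1 : MeasurableSet {x : ℕ → E n | (τ.time x : WithTop ℕ) ≤ (k : ℕ)} :=
    (Filtration.piLE (X := fun _ : ℕ => E n)).le k _ (τ.isStoppingTime k)
  have h2 : Measurable (History.extend : History n k → ℕ → E n) :=
    measurable_pi_lambda _ fun i => measurable_pi_apply _
  have h3 := (h2 h1).compl
  convert h3 using 1
  ext h
  simp [StoppingRule.Continues]

lemma measurable_transition {n N : ℕ} {Ω : Set (E n)} {ε : ℝ} (α : Set.Icc (0 : ℝ) 1)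
    (τ : StoppingRule Ω ε N) (σI σII : Strategy n ε) (k : ℕ) :
    Measurable (transition α τ σI σII k) := by
  classical
  have hI := Measure.measurable_dirac.comp (σI.measurable_move k)
  have hII := Measure.measurable_dirac.comp (σII.measurable_move k)
  have hU := (measurable_uniform n ε).comp (measurable_last (n := n) (k := k))
  have hL := Measure.measurable_dirac.comp (measurable_last (n := n) (k := k))
  refine Measurable.ite τ.measurableSet_continues ?_ hL
  refine Measure.measurable_of_measurable_coe _ fun s hs => ?_
  have hI' := (Measure.measurable_coe hs).comp hI
  have hII' := (Measure.measurable_coe hs).comp hII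
  have hU' := (Measure.measurable_coe hs).comp hU
  exact ((hI'.add hII').const_mul _).add (hU'.const_mul _)

/-- The transition probabilities as a kernel. -/
noncomputable def stepKernel {n N : ℕ} {Ω : Set (E n)} {ε : ℝ} (α : Set.Icc (0 : ℝ) 1)
    (τ : StoppingRule Ω ε N) (σI σII : Strategy n ε) (k : ℕ) : Kernel (History n k) (E n) where
  toFun := transition α τ σI σII k
  measurable' := measurable_transition α τ σI σII k

instance {n N : ℕ} {Ω : Set (E n)} {ε : ℝ} (α : Set.Icc (0 : ℝ) 1)
    (τ : StoppingRule Ω ε N) (σI σII : Strategy n ε) (k : ℕ) :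
    IsMarkovKernel (stepKernel α τ σI σII k) where
  isProbabilityMeasure h := by
    change IsProbabilityMeasure (transition α τ σI σII k h)
    unfold transition
    split_ifs
    · have hε : 0 < ε := Metric.pos_of_mem_ball (σI.move_mem k h)
      have : IsProbabilityMeasure (cond (volume : Measure (E n)) (Metric.ball h.last ε)) :=
        cond_isProbabilityMeasure_of_finite (Metric.measure_ball_pos _ _ hε).ne'
          measure_ball_lt_top.ne
      have h0 : 0 ≤ (α : ℝ) := α.2.1
      have h1 : (α : ℝ) ≤ 1 := α.2.2
      constructor
      simp only [Measure.coe_add, Measure.coe_smul, Pi.add_apply, Pi.smul_apply, measure_univ,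
        smul_eq_mul, mul_one]
      rw [one_add_one_eq_two, ← ENNReal.ofReal_ofNat 2, ← ENNReal.ofReal_mul (by positivity),
        ← ENNReal.ofReal_add (by positivity) (by linarith), ENNReal.ofReal_eq_one]
      ring
    · infer_instance

/-- The law of the run `(x₀, x₁, …)` of the game that starts at `x₀`, given by the
Ionescu-Tulcea theorem from the initial distribution `δ_{x₀}` and the transition probabilities.
From step `N` on all runs are constant. -/
noncomputable def gameMeasure {n N : ℕ} {Ω : Set (E n)} {ε : ℝ} (α : Set.Icc (0 : ℝ) 1)
    (τ : StoppingRule Ω ε N) (σI σII : Strategy n ε) (x₀ : E n) : Measure (ℕ → E n) :=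
  Kernel.trajMeasure (X := fun _ : ℕ => E n) (Measure.dirac x₀) (stepKernel α τ σI σII)

open Classical in
/-- The payoff `G`: `F` on the parabolic boundary strip, `ψ` in the cylinder. -/
noncomputable def payoff {n : ℕ} (Ω : Set (E n)) (T ε : ℝ) (F ψ : E n × ℝ → ℝ)
    (z : E n × ℝ) : ℝ :=
  if z ∈ boundaryStrip Ω T ε then F z else ψ z

/-- The number `N(t)` of rounds, i.e. the integer with `2t/ε² ≤ N(t) < 2t/ε² + 1`
(and `0` if `t ≤ 0`). -/
noncomputable def rounds (ε t : ℝ) : ℕ := ⌈2 * t / ε ^ 2⌉₊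

/-- The expected payoff `E[G(x_τ, t_τ)]`, where `t_k = t₀ - k ε²/2`, of the game that starts at
`z = (x₀, t₀)`. -/
noncomputable def expectedPayoff {n N : ℕ} {Ω : Set (E n)} {ε : ℝ} (T : ℝ)
    (α : Set.Icc (0 : ℝ) 1) (F ψ : E n × ℝ → ℝ) (z : E n × ℝ)
    (τ : StoppingRule Ω ε N) (σI σII : Strategy n ε) : ℝ :=
  ∫ x, payoff Ω T ε F ψ (x (τ.time x), z.2 - τ.time x * (ε ^ 2 / 2))
    ∂(gameMeasure α τ σI σII z.1)

/-- The value of the game for player I, as an extended real number. -/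
noncomputable def valueI {n : ℕ} (Ω : Set (E n)) (T ε : ℝ) (α : Set.Icc (0 : ℝ) 1)
    (F ψ : E n × ℝ → ℝ) (z : E n × ℝ) : EReal :=
  ⨆ (τ : StoppingRule Ω ε (rounds ε z.2)) (σI : Strategy n ε), ⨅ σII : Strategy n ε,
    ((expectedPayoff T α F ψ z τ σI σII : ℝ) : EReal)

/-- The value of the game for player II, as an extended real number. -/
noncomputable def valueII {n : ℕ} (Ω : Set (E n)) (T ε : ℝ) (α : Set.Icc (0 : ℝ) 1)
    (F ψ : E n × ℝ → ℝ) (z : E n × ℝ) : EReal :=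
  ⨅ σII : Strategy n ε, ⨆ (τ : StoppingRule Ω ε (rounds ε z.2)) (σI : Strategy n ε),
    ((expectedPayoff T α F ψ z τ σI σII : ℝ) : EReal)

end TugOfWar

/-! The dynamic programming principle is an explicit backward recursion: the slice at time `t > 0`
is computed from the slice at `t - ε²/2`, and after `rounds ε t` steps the time is nonpositive,
where only boundary data remain. Induction on the number of rounds therefore gives existence and
uniqueness (`dppSolution`, `IsDPPSolution.eqOn`).

The delicate point is Borel measurability. For fixed `t`, the supremum of any bounded function over
moving open balls is lower semicontinuous, so each slice is Borel. For joint measurability, the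
parabolic Lipschitz bounds on `F` and `ψ` make the solution 1/2-Hölder in `t` wherever the number of
rounds is constant (`abs_dppIter_sub_le`). There it is a Carathéodory function, hence Borel.

For the values, fix `η > 0` and follow `u(x_k, t_k)` along a run. If player II moves to
Borel-selected `η`-minimal points (`exists_measurable_le_iInf_add`), this process is a
supermartingale up to `η` per step, whatever player I does. If player I moves to `η`-maximal points
and stops as soon as `u ≤ ψ`, it is a submartingale up to `η`, because before stopping the maximum
is attained by the mean value term. The payoff never exceeds `u`, and under player I's rule it is at
least `u`. Optional stopping over at most `N` rounds (`integral_stopped_le`) gives `u - Nη ≤ u_I ≤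
u_II ≤ u + Nη`, and `η` is arbitrary. -/

namespace TugOfWar

/-! ### Suprema over moving balls and Borel almost-optimal selections -/

section BallSup

variable {X : Type*} [PseudoMetricSpace X]

lemma lt_iSup_ball_iff {g : X → ℝ} (hg : BddAbove (Set.range g)) {ε : ℝ} (hε : 0 < ε) {x : X}
    {c : ℝ} : c < ⨆ y : Metric.ball x ε, g y ↔ ∃ y ∈ Metric.ball x ε, c < g y := by
  have : Nonempty (Metric.ball x ε) := ⟨⟨x, Metric.mem_ball_self hε⟩⟩
  have hb : BddAbove (Set.range fun y : Metric.ball x ε => g y) :=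
    hg.mono (by rintro _ ⟨y, rfl⟩; exact ⟨y, rfl⟩)
  constructor
  · intro h
    obtain ⟨y, hy⟩ := exists_lt_of_lt_ciSup h
    exact ⟨y, y.2, hy⟩
  · rintro ⟨y, hy, h⟩
    exact h.trans_le (le_ciSup hb ⟨y, hy⟩)

/-- A ball around `x` meets a superlevel set exactly when `x` lies within `ε` of one of its points,
so the set is a union of open balls. No regularity of `g` is needed. -/
lemma isOpen_lt_iSup_ball {g : X → ℝ} (hg : BddAbove (Set.range g)) {ε : ℝ} (hε : 0 < ε) (c : ℝ) :
    IsOpen {x : X | c < ⨆ y : Metric.ball x ε, g y} := by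
  have h : {x : X | c < ⨆ y : Metric.ball x ε, g y} = ⋃ y ∈ {y | c < g y}, Metric.ball y ε := by
    ext x
    simp only [Set.mem_ofPred_eq, lt_iSup_ball_iff hg hε, Set.mem_iUnion, Metric.mem_ball',
      exists_prop, and_comm, dist_comm]
  rw [h]
  exact isOpen_biUnion fun _ _ => Metric.isOpen_ball

/-- Holds without boundedness, since real `sInf` is defined as minus the `sSup` of the negated set,
default values included. -/
lemma iInf_ball_eq_neg_iSup (g : X → ℝ) (ε : ℝ) (x : X) :
    ⨅ y : Metric.ball x ε, g y = -⨆ y : Metric.ball x ε, -g y := by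
  rw [iInf, iSup, Real.sInf_def]
  congr 2
  ext r
  simp [neg_eq_iff_eq_neg]

variable [MeasurableSpace X] [BorelSpace X]

lemma measurable_iSup_ball {g : X → ℝ} (hg : BddAbove (Set.range g)) {ε : ℝ} (hε : 0 < ε) :
    Measurable fun x : X => ⨆ y : Metric.ball x ε, g y :=
  measurable_of_Ioi fun c => (isOpen_lt_iSup_ball hg hε c).measurableSet

lemma measurable_iInf_ball {g : X → ℝ} (hg : BddBelow (Set.range g)) {ε : ℝ} (hε : 0 < ε) :
    Measurable fun x : X => ⨅ y : Metric.ball x ε, g y := by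
  simp_rw [iInf_ball_eq_neg_iSup g]
  refine (measurable_iSup_ball (g := fun y => -g y) ?_ hε).neg
  obtain ⟨m, hm⟩ := hg
  exact ⟨-m, by rintro _ ⟨y, rfl⟩; exact neg_le_neg (hm ⟨y, rfl⟩)⟩

variable [SecondCountableTopology X]

/-- A Borel selection of almost maximal points in the balls of radius `ε`. -/
lemma exists_measurable_iSup_sub_le [Nonempty X] {g : X → ℝ} (hg : BddAbove (Set.range g))
    {ε η : ℝ} (hε : 0 < ε) (hη : 0 < η) :
    ∃ s : X → X, Measurable s ∧
      ∀ x, s x ∈ Metric.ball x ε ∧ (⨆ y : Metric.ball x ε, g y) - η ≤ g (s x) := by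
  classical
  -- Countable dense subsets of the rational superlevel sets supply enough candidates: an open ball
  -- that meets a superlevel set meets its dense subset. Choosing the first suitable candidate in an
  -- enumeration is then Borel. The arbitrary extra point only keeps the candidate set nonempty.
  have hd : ∀ q : ℚ, ∃ D : Set X, D ⊆ {y | (q : ℝ) < g y} ∧ D.Countable ∧
      {y | (q : ℝ) < g y} ⊆ closure D := fun q =>
    (TopologicalSpace.IsSeparable.of_separableSpace {y | (q : ℝ) < g y}).exists_countable_dense_subset
  choose D hDs hDc hDd using hd
  have hkey : ∀ x, ∃ d ∈ (⋃ q, D q) ∪ {Classical.arbitrary X}, d ∈ Metric.ball x ε ∧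
      (⨆ y : Metric.ball x ε, g y) - η < g d := by
    intro x
    obtain ⟨q, hq1, hq2⟩ := exists_rat_btwn (sub_lt_self (⨆ y : Metric.ball x ε, g y) hη)
    obtain ⟨y, hy, hqy⟩ := (lt_iSup_ball_iff hg hε).1 hq2
    obtain ⟨d, hdb, hdD⟩ := mem_closure_iff.1 (hDd q hqy) _ Metric.isOpen_ball hy
    exact ⟨d, Or.inl (Set.mem_iUnion.2 ⟨q, hdD⟩), hdb, hq1.trans (hDs q hdD)⟩
  obtain ⟨d, hd⟩ := ((Set.countable_iUnion hDc).union
    (Set.countable_singleton (Classical.arbitrary X))).exists_eq_range ⟨_, Or.inr rfl⟩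
  rw [hd] at hkey
  have hex : ∀ x, ∃ i, d i ∈ Metric.ball x ε ∧ (⨆ y : Metric.ball x ε, g y) - η < g (d i) := by
    intro x
    obtain ⟨_, ⟨i, rfl⟩, h⟩ := hkey x
    exact ⟨i, h⟩
  refine ⟨fun x => d (Nat.find (hex x)), ?_, fun x =>
    ⟨(Nat.find_spec (hex x)).1, (Nat.find_spec (hex x)).2.le⟩⟩
  refine (measurable_from_nat (f := d)).comp (measurable_find hex fun k => ?_)
  have h1 : MeasurableSet {x | d k ∈ Metric.ball x ε} := by
    simp_rw [Metric.mem_ball']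
    exact measurableSet_ball
  exact h1.inter (measurableSet_lt ((measurable_iSup_ball hg hε).sub_const η) measurable_const)

lemma exists_measurable_le_iInf_add [Nonempty X] {g : X → ℝ} (hg : BddBelow (Set.range g))
    {ε η : ℝ} (hε : 0 < ε) (hη : 0 < η) :
    ∃ s : X → X, Measurable s ∧
      ∀ x, s x ∈ Metric.ball x ε ∧ g (s x) ≤ (⨅ y : Metric.ball x ε, g y) + η := by
  obtain ⟨m, hm⟩ := hg
  obtain ⟨s, hs, h⟩ := exists_measurable_iSup_sub_le (g := fun y => -g y)
    ⟨-m, by rintro _ ⟨y, rfl⟩; exact neg_le_neg (hm ⟨y, rfl⟩)⟩ hε hη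
  refine ⟨s, hs, fun x => ⟨(h x).1, ?_⟩⟩
  rw [iInf_ball_eq_neg_iSup]
  linarith [(h x).2]

end BallSup

lemma setAverage_eq_integral_cond {X : Type*} [MeasurableSpace X] (μ : Measure X) (s : Set X)
    (f : X → ℝ) : ⨍ y in s, f y ∂μ = ∫ y, f y ∂(cond μ s) := by
  rw [average, Measure.restrict_apply_univ]
  rfl

variable {n : ℕ}

lemma isProbabilityMeasure_cond_ball {ε : ℝ} (hε : 0 < ε) (x : E n) :
    IsProbabilityMeasure (cond (volume : Measure (E n)) (Metric.ball x ε)) :=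
  cond_isProbabilityMeasure_of_finite (Metric.measure_ball_pos _ _ hε).ne'
    measure_ball_lt_top.ne

/-- The uniform distributions in the balls of radius `ε` as a kernel. -/
noncomputable def uniformKernel (n : ℕ) (ε : ℝ) : Kernel (E n) (E n) where
  toFun x := cond volume (Metric.ball x ε)
  measurable' := measurable_uniform n ε

lemma measurable_ballAverage {g : E n → ℝ} (hg : Measurable g) (ε : ℝ) :
    Measurable fun x => ⨍ y in Metric.ball x ε, g y := by
  simp_rw [setAverage_eq_integral_cond]
  exact (hg.stronglyMeasurable.integral_kernel (κ := uniformKernel n ε)).measurable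

/-! ### Geometry of the boundary strip and parabolic Lipschitz functions -/

section Geometry

variable {Ω : Set (E n)} {T ε t : ℝ} {x y : E n}

/-- The segment from `x` to a point outside `Ω` is connected, so it crosses the frontier at a
distance less than `ε` from its endpoint. -/
lemma mem_or_mem_outerStrip (hΩ : IsOpen Ω) (hx : x ∈ Ω) (hy : y ∈ Metric.ball x ε) :
    y ∈ Ω ∨ y ∈ outerStrip Ω ε := by
  by_cases hyΩ : y ∈ Ω
  · exact Or.inl hyΩ
  refine Or.inr ⟨hyΩ, ?_⟩
  obtain ⟨z, hz, hzf⟩ : (segment ℝ x y ∩ frontier Ω).Nonempty := by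
    by_contra h
    rw [Set.not_nonempty_iff_eq_empty] at h
    have hsub : segment ℝ x y ⊆ Ω ∪ (closure Ω)ᶜ := by
      intro w hw
      by_cases hwΩ : w ∈ Ω
      · exact Or.inl hwΩ
      · refine Or.inr fun hwc => ?_
        have : w ∈ segment ℝ x y ∩ frontier Ω := ⟨hw, hwc, by rwa [hΩ.interior_eq]⟩
        simp [h] at this
    have hdisj : Disjoint Ω (closure Ω)ᶜ :=
      Set.disjoint_compl_right_iff_subset.2 subset_closure
    have := (convex_segment x y).isPreconnected.subset_left_of_subset_union hΩ
      isClosed_closure.isOpen_compl hdisj hsub ⟨x, left_mem_segment ℝ x y, hx⟩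
    exact hyΩ (this (right_mem_segment ℝ x y))
  refine (Metric.infDist_le_dist_of_mem hzf).trans ?_
  have h1 := dist_add_dist_of_mem_segment hz
  rw [Metric.mem_ball, dist_comm] at hy
  rw [dist_comm]
  linarith [dist_nonneg (x := x) (y := z)]

lemma isClosed_outerStrip (hΩ : IsOpen Ω) : IsClosed (outerStrip Ω ε) :=
  hΩ.isClosed_compl.inter (isClosed_le (Metric.continuous_infDist_pt _) continuous_const)

lemma measurableSet_boundaryStrip (hΩ : IsOpen Ω) : MeasurableSet (boundaryStrip Ω T ε) :=
  ((isClosed_outerStrip hΩ).measurableSet.prod measurableSet_Ioc).union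
    (hΩ.measurableSet.prod measurableSet_Ioc)

lemma measurableSet_cylinder (hΩ : IsOpen Ω) : MeasurableSet (cylinder Ω T) :=
  hΩ.measurableSet.prod measurableSet_Ioo

lemma isBounded_outerStrip (hne : Ω.Nonempty) (hb : Bornology.IsBounded Ω) :
    Bornology.IsBounded (outerStrip Ω ε) := by
  -- `infDist` to the empty set is `0`, so an empty frontier imposes no distance bound. In that case
  -- a nonempty `Ω` is the whole space and the strip is empty.
  rcases (frontier Ω).eq_empty_or_nonempty with h | h
  · rcases frontier_eq_empty_iff.1 h with h | h
    · exact absurd h hne.ne_empty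
    · have : outerStrip Ω ε = ∅ := by ext x; simp [outerStrip, h]
      rw [this]
      exact Bornology.isBounded_empty
  · have hf : Bornology.IsBounded (frontier Ω) := hb.closure.subset frontier_subset_closure
    refine (hf.cthickening (δ := ε)).subset fun x hx => ?_
    rw [Metric.mem_cthickening_iff,
      ← ENNReal.ofReal_toReal (Metric.infEDist_ne_top h)]
    exact ENNReal.ofReal_le_ofReal hx.2

lemma isBounded_boundaryStrip (hne : Ω.Nonempty) (hb : Bornology.IsBounded Ω) :
    Bornology.IsBounded (boundaryStrip Ω T ε) :=
  ((isBounded_outerStrip hne hb).prod (Metric.isBounded_Ioc _ _)).union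
    (hb.prod (Metric.isBounded_Ioc _ _))

lemma notMem_boundaryStrip_of_mem_cylinder {z : E n × ℝ} (hz : z ∈ cylinder Ω T) :
    z ∉ boundaryStrip Ω T ε := by
  rintro (h | h)
  · exact h.1.1 hz.1
  · exact absurd hz.2.1 (not_lt.2 h.2.2)

lemma mem_extendedCylinder_of_mem_ball (hΩ : IsOpen Ω) (hx : (x, t) ∈ cylinder Ω T)
    (hy : y ∈ Metric.ball x ε) : (y, t - ε ^ 2 / 2) ∈ extendedCylinder Ω T ε := by
  obtain ⟨hxΩ, ht0, htT⟩ := hx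
  have hε2 : 0 ≤ ε ^ 2 := sq_nonneg ε
  simp only at hxΩ ht0 htT
  rcases mem_or_mem_outerStrip hΩ hxΩ hy with h | h
  · rcases le_or_gt (t - ε ^ 2 / 2) 0 with h0 | h0
    · exact Or.inr (Or.inr ⟨h, by simp; linarith, h0⟩)
    · exact Or.inl ⟨h, h0, by simp; linarith⟩
  · exact Or.inr (Or.inl ⟨h, by simp; linarith, by simp; linarith⟩)

lemma ParabolicLipschitzOn.continuousOn {C : ℝ} {f : E n × ℝ → ℝ} {A : Set (E n × ℝ)}
    (hf : ParabolicLipschitzOn C f A) : ContinuousOn f A := by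
  intro z hz
  rw [ContinuousWithinAt, tendsto_iff_dist_tendsto_zero]
  have hc : Continuous fun w : E n × ℝ => C * (‖w.1 - z.1‖ + √|w.2 - z.2|) := by fun_prop
  have h0 := (hc.tendsto z).mono_left (nhdsWithin_le_nhds (s := A))
  simp only [sub_self, norm_zero, abs_zero, Real.sqrt_zero, add_zero, mul_zero] at h0
  refine squeeze_zero' (Filter.Eventually.of_forall fun _ => dist_nonneg) ?_ h0
  filter_upwards [self_mem_nhdsWithin] with w hw
  rw [Real.dist_eq]
  exact hf w hw z hz

lemma ParabolicLipschitzOn.exists_abs_le {C : ℝ} {f : E n × ℝ → ℝ} {A : Set (E n × ℝ)}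
    (hf : ParabolicLipschitzOn C f A) (hA : Bornology.IsBounded A) :
    ∃ M, ∀ z ∈ A, |f z| ≤ M := by
  rcases A.eq_empty_or_nonempty with rfl | ⟨w, hw⟩
  · exact ⟨0, by simp⟩
  obtain ⟨R, hR⟩ := Metric.isBounded_iff.1 hA
  refine ⟨|f w| + |C| * (R + √R), fun z hz => ?_⟩
  have hd : max (dist z.1 w.1) (dist z.2 w.2) ≤ R := hR hz hw
  rw [dist_eq_norm, Real.dist_eq] at hd
  have h1 : |f z - f w| ≤ |C| * (R + √R) := (hf z hz w hw).trans <| by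
    gcongr
    · exact le_abs_self C
    · exact (le_max_left _ _).trans hd
    · exact (le_max_right _ _).trans hd
  linarith [abs_sub_abs_le_abs_sub (f z) (f w)]

end Geometry

end TugOfWar

namespace TugOfWar

variable {n : ℕ}

/-! ### The mean value operator -/

/-- The mean value operator of the dynamic programming principle. -/
noncomputable def dppOp (α : Set.Icc (0 : ℝ) 1) (ε : ℝ) (g : E n → ℝ) (x : E n) : ℝ :=
  (α : ℝ) / 2 * ((⨆ y : Metric.ball x ε, g y) + ⨅ y : Metric.ball x ε, g y) +
    (1 - (α : ℝ)) * ⨍ y in Metric.ball x ε, g y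

lemma integrable_of_abs_le {X : Type*} [MeasurableSpace X] {μ : Measure X} [IsFiniteMeasure μ]
    {f : X → ℝ} {M : ℝ} (hf : Measurable f) (hM : ∀ x, |f x| ≤ M) : Integrable f μ :=
  Integrable.of_bound hf.aestronglyMeasurable M (Filter.Eventually.of_forall hM)

lemma bddAbove_of_abs_le {X : Type*} {f : X → ℝ} {M : ℝ} (hM : ∀ x, |f x| ≤ M) :
    BddAbove (Set.range f) :=
  ⟨M, by rintro _ ⟨x, rfl⟩; exact (abs_le.1 (hM x)).2⟩

lemma bddBelow_of_abs_le {X : Type*} {f : X → ℝ} {M : ℝ} (hM : ∀ x, |f x| ≤ M) :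
    BddBelow (Set.range f) :=
  ⟨-M, by rintro _ ⟨x, rfl⟩; exact (abs_le.1 (hM x)).1⟩

section Operator

variable {α : Set.Icc (0 : ℝ) 1} {ε M : ℝ} {g g' : E n → ℝ}

lemma dppOp_congr {x : E n} (h : ∀ y ∈ Metric.ball x ε, g y = g' y) :
    dppOp α ε g x = dppOp α ε g' x := by
  have h' : (fun y : Metric.ball x ε => g y) = fun y : Metric.ball x ε => g' y :=
    funext fun y => h y y.2
  rw [dppOp, dppOp, h', setAverage_congr_fun measurableSet_ball (Filter.Eventually.of_forall h)]

lemma ae_cond_ball {ε : ℝ} (x : E n) :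
    ∀ᵐ y ∂(cond (volume : Measure (E n)) (Metric.ball x ε)), y ∈ Metric.ball x ε :=
  ae_cond_mem measurableSet_ball

/-- The operator is monotone and commutes with adding constants, because its weights `α/2`, `α/2`,
`1 - α` are nonnegative and sum to one. Nonexpansiveness in the sup norm follows. -/
lemma dppOp_le_add (hε : 0 < ε) (hg : Measurable g) (hgM : ∀ x, |g x| ≤ M) (hg' : Measurable g')
    (hgM' : ∀ x, |g' x| ≤ M) {x : E n} {c : ℝ} (h : ∀ y ∈ Metric.ball x ε, g y ≤ g' y + c) :
    dppOp α ε g x ≤ dppOp α ε g' x + c := by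
  have : Nonempty (Metric.ball x ε) := ⟨⟨x, Metric.mem_ball_self hε⟩⟩
  have := isProbabilityMeasure_cond_ball hε x
  have h1 : (⨆ y : Metric.ball x ε, g y) ≤ (⨆ y : Metric.ball x ε, g' y) + c :=
    ciSup_le fun y => (h y y.2).trans <| add_le_add_left
      (le_ciSup (f := fun y : Metric.ball x ε => g' y)
        (bddAbove_of_abs_le fun y => hgM' y) y) c
  have h2 : (⨅ y : Metric.ball x ε, g y) ≤ (⨅ y : Metric.ball x ε, g' y) + c := by
    rw [← sub_le_iff_le_add]
    exact le_ciInf fun y => sub_le_iff_le_add.2 <|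
      (ciInf_le (f := fun y : Metric.ball x ε => g y)
        (bddBelow_of_abs_le fun y => hgM y) y).trans (h y y.2)
  have h3 : ⨍ y in Metric.ball x ε, g y ≤ (⨍ y in Metric.ball x ε, g' y) + c := by
    simp_rw [setAverage_eq_integral_cond]
    calc _ ≤ ∫ y, (g' y + c) ∂(cond volume (Metric.ball x ε)) :=
          integral_mono_ae (integrable_of_abs_le hg hgM)
            ((integrable_of_abs_le hg' hgM').add (integrable_const c))
            ((ae_cond_ball x).mono h)
      _ = _ := by
          rw [integral_add (integrable_of_abs_le hg' hgM') (integrable_const c)]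
          simp
  have hα0 : 0 ≤ (α : ℝ) / 2 := div_nonneg α.2.1 two_pos.le
  have hα1 : 0 ≤ 1 - (α : ℝ) := sub_nonneg.2 α.2.2
  have h4 := mul_le_mul_of_nonneg_left (add_le_add h1 h2) hα0
  have h5 := mul_le_mul_of_nonneg_left h3 hα1
  rw [dppOp, dppOp]
  linarith

lemma abs_dppOp_sub_le (hε : 0 < ε) (hg : Measurable g) (hgM : ∀ x, |g x| ≤ M)
    (hg' : Measurable g') (hgM' : ∀ x, |g' x| ≤ M) {x : E n} {c : ℝ}
    (h : ∀ y ∈ Metric.ball x ε, |g y - g' y| ≤ c) :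
    |dppOp α ε g x - dppOp α ε g' x| ≤ c := by
  have h1 := dppOp_le_add (α := α) hε hg hgM hg' hgM' (x := x) (c := c)
    fun y hy => by linarith [(abs_le.1 (h y hy)).2]
  have h2 := dppOp_le_add (α := α) hε hg' hgM' hg hgM (x := x) (c := c)
    fun y hy => by linarith [(abs_le.1 (h y hy)).1]
  exact abs_le.2 ⟨by linarith, by linarith⟩

lemma abs_dppOp_le (hε : 0 < ε) (hg : Measurable g) (hgM : ∀ x, |g x| ≤ M) (x : E n) :
    |dppOp α ε g x| ≤ M := by
  have h0 : dppOp α ε (fun _ : E n => (0 : ℝ)) x = 0 := by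
    have : Nonempty (Metric.ball x ε) := ⟨⟨x, Metric.mem_ball_self hε⟩⟩
    simp [dppOp]
  have := abs_dppOp_sub_le (α := α) hε hg hgM (g' := fun _ => 0) measurable_const
    (fun y => by simpa using (abs_nonneg _).trans (hgM y)) (x := x) (c := M)
    fun y _ => by simpa using hgM y
  rwa [h0, sub_zero] at this

lemma measurable_dppOp (hε : 0 < ε) (hg : Measurable g) (hgM : ∀ x, |g x| ≤ M) :
    Measurable (dppOp α ε g) :=
  (((measurable_iSup_ball (bddAbove_of_abs_le hgM) hε).add
    (measurable_iInf_ball (bddBelow_of_abs_le hgM) hε)).const_mul _).add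
    ((measurable_ballAverage hg ε).const_mul _)

end Operator

/-! ### Counting rounds -/

section Rounds

variable {ε t : ℝ}

lemma rounds_of_nonpos (ht : t ≤ 0) : rounds ε t = 0 :=
  Nat.ceil_eq_zero.2 (div_nonpos_of_nonpos_of_nonneg (by linarith) (sq_nonneg ε))

lemma rounds_pos (hε : 0 < ε) (ht : 0 < t) : 0 < rounds ε t :=
  Nat.ceil_pos.2 (by positivity)

lemma rounds_eq_succ (hε : 0 < ε) (ht : 0 < t) : rounds ε t = rounds ε (t - ε ^ 2 / 2) + 1 := by
  have h : 2 * (t - ε ^ 2 / 2) / ε ^ 2 = 2 * t / ε ^ 2 - 1 := by field_simp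
  have h1 := rounds_pos hε ht
  rw [rounds, rounds, h, Nat.ceil_sub_one]
  rw [rounds] at h1
  omega

lemma measurable_rounds (ε : ℝ) : Measurable (rounds ε) :=
  Nat.measurable_ceil.comp ((measurable_id.const_mul 2).div_const _)

lemma sub_mul_pos_of_lt_rounds (hε : 0 < ε) {k : ℕ} (hk : k < rounds ε t) :
    0 < t - k * (ε ^ 2 / 2) := by
  rw [rounds, Nat.lt_ceil, lt_div_iff₀ (by positivity)] at hk
  linarith

lemma sub_rounds_mul_nonpos (hε : 0 < ε) : t - rounds ε t * (ε ^ 2 / 2) ≤ 0 := by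
  have := Nat.le_ceil (2 * t / ε ^ 2)
  rw [div_le_iff₀ (by positivity)] at this
  rw [rounds]
  linarith

end Rounds

open Classical in
/-- Iterated solution of the dynamic programming principle: `dppIter … k t` is the time slice at
the time `t` if `k` rounds are left. -/
noncomputable def dppIter (Ω : Set (E n)) (T ε : ℝ) (α : Set.Icc (0 : ℝ) 1)
    (F ψ : E n × ℝ → ℝ) : ℕ → ℝ → E n → ℝ
  | 0, t, x => (boundaryStrip Ω T ε).indicator F (x, t)
  | k + 1, t, x =>
    if (x, t) ∈ cylinder Ω T then
      max (ψ (x, t)) (dppOp α ε (dppIter Ω T ε α F ψ k (t - ε ^ 2 / 2)) x)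
    else (boundaryStrip Ω T ε).indicator F (x, t)

/-- The solution of the dynamic programming principle, extended by zero. -/
noncomputable def dppSolution (Ω : Set (E n)) (T ε : ℝ) (α : Set.Icc (0 : ℝ) 1)
    (F ψ : E n × ℝ → ℝ) (z : E n × ℝ) : ℝ :=
  dppIter Ω T ε α F ψ (rounds ε z.2) z.2 z.1

/-! ### Construction, measurability and uniqueness of the solution -/

section Solution

variable {Ω : Set (E n)} {T ε M : ℝ} {α : Set.Icc (0 : ℝ) 1} {F ψ : E n × ℝ → ℝ}

lemma dppIter_of_notMem {k : ℕ} {t : ℝ} {x : E n} (h : (x, t) ∉ cylinder Ω T) :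
    dppIter Ω T ε α F ψ k t x = (boundaryStrip Ω T ε).indicator F (x, t) := by
  cases k with
  | zero => rfl
  | succ k => rw [dppIter, if_neg h]

lemma dppSolution_of_mem_cylinder (hε : 0 < ε) {x : E n} {t : ℝ} (h : (x, t) ∈ cylinder Ω T) :
    dppSolution Ω T ε α F ψ (x, t) =
      max (ψ (x, t)) (dppOp α ε (fun y => dppSolution Ω T ε α F ψ (y, t - ε ^ 2 / 2)) x) := by
  rw [dppSolution, rounds_eq_succ hε h.2.1, dppIter, if_pos h]
  rfl

lemma dppSolution_of_notMem_cylinder {z : E n × ℝ} (h : z ∉ cylinder Ω T) :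
    dppSolution Ω T ε α F ψ z = (boundaryStrip Ω T ε).indicator F z :=
  dppIter_of_notMem h

lemma measurable_indicator_boundaryStrip (hΩ : IsOpen Ω)
    (hF : ContinuousOn F (boundaryStrip Ω T ε)) :
    Measurable ((boundaryStrip Ω T ε).indicator F) := by
  classical
  rw [← Set.piecewise_eq_indicator]
  exact hF.measurable_piecewise continuousOn_const (measurableSet_boundaryStrip hΩ)

/-- The two claims go through the induction together: measurability of the suprema and infima needs
the bound, and the bound on the averages needs measurability. -/
lemma dppIter_measurable_and_abs_le (hΩ : IsOpen Ω) (hε : 0 < ε)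
    (hF : ContinuousOn F (boundaryStrip Ω T ε)) (hψ : Continuous ψ) (hM : 0 ≤ M)
    (hFM : ∀ z ∈ boundaryStrip Ω T ε, |F z| ≤ M) (hψM : ∀ z ∈ cylinder Ω T, |ψ z| ≤ M)
    (k : ℕ) : ∀ t, Measurable (dppIter Ω T ε α F ψ k t) ∧ ∀ x, |dppIter Ω T ε α F ψ k t x| ≤ M := by
  have hG : ∀ z, |(boundaryStrip Ω T ε).indicator F z| ≤ M := by
    intro z
    by_cases hz : z ∈ boundaryStrip Ω T ε
    · rw [Set.indicator_of_mem hz]; exact hFM z hz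
    · rw [Set.indicator_of_notMem hz]; simpa using hM
  induction k with
  | zero =>
    exact fun t => ⟨(measurable_indicator_boundaryStrip hΩ hF).comp measurable_prodMk_right,
      fun x => hG _⟩
  | succ k ih =>
    intro t
    obtain ⟨h1, h2⟩ := ih (t - ε ^ 2 / 2)
    constructor
    · refine Measurable.ite (measurable_prodMk_right (measurableSet_cylinder hΩ)) ?_
        ((measurable_indicator_boundaryStrip hΩ hF).comp measurable_prodMk_right)
      exact (hψ.measurable.comp measurable_prodMk_right).max (measurable_dppOp hε h1 h2)
    · intro x
      rw [dppIter]
      split_ifs with h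
      · exact abs_max_le_max_abs_abs.trans (max_le (hψM _ h) (abs_dppOp_le hε h1 h2 x))
      · exact hG _

/-- Both times shift by the same `ε²/2`, so `t - s` is preserved by the recursion, and the operator
is nonexpansive. The constant therefore does not grow with `k`. -/
lemma abs_dppIter_sub_le (hΩ : IsOpen Ω) (hε : 0 < ε) {C₁ C₂ : ℝ}
    (hF : ParabolicLipschitzOn C₁ F (boundaryStrip Ω T ε))
    (hψ : ParabolicLipschitzOn C₂ ψ Set.univ) (hM : 0 ≤ M)
    (hFM : ∀ z ∈ boundaryStrip Ω T ε, |F z| ≤ M) (hψM : ∀ z ∈ cylinder Ω T, |ψ z| ≤ M)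
    (k : ℕ) : ∀ t s, rounds ε t = k → rounds ε s = k → ∀ x, (x, t) ∈ extendedCylinder Ω T ε →
      (x, s) ∈ extendedCylinder Ω T ε →
      |dppIter Ω T ε α F ψ k t x - dppIter Ω T ε α F ψ k s x| ≤ max C₁ C₂ * √|t - s| := by
  have hψc : Continuous ψ := continuousOn_univ.1 hψ.continuousOn
  -- The number of rounds is positive exactly for positive times, so equal counts put both points in
  -- the cylinder or both in the boundary strip.
  have hmem : ∀ {x : E n} {t s : ℝ}, rounds ε t = rounds ε s → (x, t) ∈ cylinder Ω T →
      (x, s) ∈ extendedCylinder Ω T ε → (x, s) ∈ cylinder Ω T := by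
    intro x t s hts ht hs
    refine hs.resolve_right fun h => ?_
    rcases h with h | h
    · exact h.1.1 ht.1
    · have := rounds_pos hε ht.2.1
      rw [hts, rounds_of_nonpos h.2.2] at this
      exact lt_irrefl _ this
  have hbdry : ∀ {k : ℕ} {x : E n} {t s : ℝ}, (x, t) ∉ cylinder Ω T → (x, s) ∉ cylinder Ω T →
      (x, t) ∈ extendedCylinder Ω T ε → (x, s) ∈ extendedCylinder Ω T ε →
      |dppIter Ω T ε α F ψ k t x - dppIter Ω T ε α F ψ k s x| ≤ max C₁ C₂ * √|t - s| := by
    intro k x t s ht hs ht' hs'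
    have ht'' := ht'.resolve_left ht
    have hs'' := hs'.resolve_left hs
    rw [dppIter_of_notMem ht, dppIter_of_notMem hs, Set.indicator_of_mem ht'',
      Set.indicator_of_mem hs'']
    refine (hF _ ht'' _ hs'').trans ?_
    simp only [sub_self, norm_zero, zero_add]
    gcongr
    exact le_max_left _ _
  induction k with
  | zero =>
    intro t s ht hs x hxt hxs
    refine hbdry (fun h => ?_) (fun h => ?_) hxt hxs
    · exact (rounds_pos hε h.2.1).ne' ht
    · exact (rounds_pos hε h.2.1).ne' hs
  | succ k ih =>
    intro t s ht hs x hxt hxs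
    by_cases hc : (x, t) ∈ cylinder Ω T
    · have hc' := hmem (ht.trans hs.symm) hc hxs
      rw [dppIter, dppIter, if_pos hc, if_pos hc']
      obtain ⟨m1, b1⟩ := dppIter_measurable_and_abs_le (α := α) hΩ hε hF.continuousOn hψc hM hFM
        hψM k (t - ε ^ 2 / 2)
      obtain ⟨m2, b2⟩ := dppIter_measurable_and_abs_le (α := α) hΩ hε hF.continuousOn hψc hM hFM
        hψM k (s - ε ^ 2 / 2)
      refine (abs_max_sub_max_le_max _ _ _ _).trans (max_le ?_ ?_)
      · refine (hψ _ trivial _ trivial).trans ?_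
        simp only [sub_self, norm_zero, zero_add]
        gcongr
        exact le_max_right _ _
      · refine abs_dppOp_sub_le hε m1 b1 m2 b2 fun y hy => ?_
        have h1 := rounds_eq_succ hε hc.2.1
        have h2 := rounds_eq_succ hε hc'.2.1
        simp only at h1 h2
        have := ih (t - ε ^ 2 / 2) (s - ε ^ 2 / 2) (by omega) (by omega) y
          (mem_extendedCylinder_of_mem_ball hΩ hc hy) (mem_extendedCylinder_of_mem_ball hΩ hc' hy)
        rwa [sub_sub_sub_cancel_right] at this
    · exact hbdry hc (fun h => hc (hmem (hs.trans ht.symm) h hxt)) hxt hxs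

lemma continuous_of_abs_sub_le_sqrt {S : Set ℝ} {f : S → ℝ} {C : ℝ}
    (h : ∀ t s, |f t - f s| ≤ C * √|(t : ℝ) - s|) : Continuous f := by
  rw [continuous_iff_continuousAt]
  intro s
  rw [ContinuousAt, tendsto_iff_dist_tendsto_zero]
  have hc : Continuous fun t : S => C * √|(t : ℝ) - s| := by fun_prop
  have h0 := hc.tendsto s
  simp only [sub_self, abs_zero, Real.sqrt_zero, mul_zero] at h0
  exact squeeze_zero (fun _ => dist_nonneg) (fun t => by rw [Real.dist_eq]; exact h t s) h0

lemma measurable_of_measurable_cover {X Y ι : Type*} [MeasurableSpace X] [MeasurableSpace Y]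
    [Countable ι] {f : X → Y} (s : ι → Set X) (hs : ∀ i, MeasurableSet (s i))
    (hU : ⋃ i, s i = Set.univ) (hf : ∀ i, Measurable ((s i).domRestrict f)) : Measurable f := by
  have hc : ∀ (i j : ι) (x : X) (hxi : x ∈ s i) (hxj : x ∈ s j),
      (s i).domRestrict f ⟨x, hxi⟩ = (s j).domRestrict f ⟨x, hxj⟩ := fun _ _ _ _ _ => rfl
  have h := measurable_liftCover s hs (fun i => (s i).domRestrict f) hf hc hU
  convert h using 1
  ext x
  obtain ⟨i, hi⟩ := Set.mem_iUnion.1 (hU ▸ Set.mem_univ x : x ∈ ⋃ i, s i)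
  exact (Set.liftCover_of_mem (f := fun i => (s i).domRestrict f) hi).symm

lemma measurable_dppSolution (hΩ : IsOpen Ω) (hε : 0 < ε) {C₁ C₂ : ℝ}
    (hF : ParabolicLipschitzOn C₁ F (boundaryStrip Ω T ε))
    (hψ : ParabolicLipschitzOn C₂ ψ Set.univ) (hM : 0 ≤ M)
    (hFM : ∀ z ∈ boundaryStrip Ω T ε, |F z| ≤ M) (hψM : ∀ z ∈ cylinder Ω T, |ψ z| ≤ M) :
    Measurable (dppSolution Ω T ε α F ψ) := by
  have hψc : Continuous ψ := continuousOn_univ.1 hψ.continuousOn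
  let s : Option ℕ → Set (E n × ℝ) := fun o =>
    o.elim (cylinder Ω T)ᶜ fun k => cylinder Ω T ∩ {z | rounds ε z.2 = k}
  refine measurable_of_measurable_cover s ?_ ?_ ?_
  · rintro (_ | k)
    · exact (measurableSet_cylinder hΩ).compl
    · exact (measurableSet_cylinder hΩ).inter
        ((measurable_rounds ε).comp measurable_snd (measurableSet_singleton k))
  · refine Set.eq_univ_of_forall fun z => Set.mem_iUnion.2 ?_
    by_cases hz : z ∈ cylinder Ω T
    · exact ⟨some (rounds ε z.2), hz, rfl⟩
    · exact ⟨none, hz⟩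
  · rintro (_ | k)
    · have : (s none).domRestrict (dppSolution Ω T ε α F ψ) =
          (s none).domRestrict ((boundaryStrip Ω T ε).indicator F) :=
        funext fun z => dppSolution_of_notMem_cylinder z.2
      rw [this]
      exact (measurable_indicator_boundaryStrip hΩ hF.continuousOn).comp measurable_subtype_coe
    · let I : Set ℝ := Set.Ioo 0 T ∩ {t | rounds ε t = k}
      have hm : Measurable (Function.uncurry fun (t : I) (x : Ω) => dppIter Ω T ε α F ψ k t x) := by
        -- Carathéodory: continuous in `t` and Borel in `x` implies jointly Borel.
        refine measurable_uncurry_of_continuous_of_measurable (fun x => ?_) fun t => ?_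
        · exact continuous_of_abs_sub_le_sqrt fun t s =>
            abs_dppIter_sub_le hΩ hε hF hψ hM hFM hψM k t s t.2.2 s.2.2 x
              (Or.inl ⟨x.2, t.2.1⟩) (Or.inl ⟨x.2, s.2.1⟩)
        · exact (dppIter_measurable_and_abs_le hΩ hε hF.continuousOn hψc hM hFM hψM k t).1.comp
            measurable_subtype_coe
      have hφ : Measurable fun z : s (some k) =>
          ((⟨z.1.2, z.2.1.2, z.2.2⟩ : I), (⟨z.1.1, z.2.1.1⟩ : Ω)) :=
        (measurable_subtype_coe.snd.subtype_mk).prodMk (measurable_subtype_coe.fst.subtype_mk)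
      convert hm.comp hφ using 1
      ext z
      have hz : rounds ε z.1.2 = k := z.2.2
      simp [Set.domRestrict, dppSolution, Function.uncurry, hz]

lemma isDPPSolution_dppSolution (hΩ : IsOpen Ω) (hε : 0 < ε) {C₁ C₂ : ℝ}
    (hF : ParabolicLipschitzOn C₁ F (boundaryStrip Ω T ε))
    (hψ : ParabolicLipschitzOn C₂ ψ Set.univ) (hM : 0 ≤ M)
    (hFM : ∀ z ∈ boundaryStrip Ω T ε, |F z| ≤ M) (hψM : ∀ z ∈ cylinder Ω T, |ψ z| ≤ M) :
    IsDPPSolution Ω T ε α F ψ (dppSolution Ω T ε α F ψ) where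
  borel := (measurable_dppSolution hΩ hε hF hψ hM hFM hψM).comp measurable_subtype_coe
  bounded := ⟨M, fun z _ => (dppIter_measurable_and_abs_le hΩ hε hF.continuousOn
    (continuousOn_univ.1 hψ.continuousOn) hM hFM hψM _ _).2 _⟩
  interior_eq x hx t ht := dppSolution_of_mem_cylinder hε ⟨hx, ht⟩
  boundary_eq z hz := by
    rw [dppSolution_of_notMem_cylinder fun h => notMem_boundaryStrip_of_mem_cylinder h hz,
      Set.indicator_of_mem hz]

/-- The recursion alone determines the values; neither boundedness nor measurability enters. -/
lemma IsDPPSolution.eqOn (hΩ : IsOpen Ω) (hε : 0 < ε) {u v : E n × ℝ → ℝ}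
    (hu : IsDPPSolution Ω T ε α F ψ u) (hv : IsDPPSolution Ω T ε α F ψ v) :
    Set.EqOn v u (extendedCylinder Ω T ε) := by
  suffices h : ∀ k x t, rounds ε t = k → (x, t) ∈ extendedCylinder Ω T ε → v (x, t) = u (x, t) from
    fun z hz => h _ z.1 z.2 rfl hz
  intro k
  induction k with
  | zero =>
    intro x t ht hz
    have hb := hz.resolve_left fun h => (rounds_pos hε h.2.1).ne' ht
    rw [hu.boundary_eq _ hb, hv.boundary_eq _ hb]
  | succ k ih =>
    rintro x t ht (hz | hb)
    · have h1 := rounds_eq_succ hε hz.2.1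
      simp only at h1
      rw [hu.interior_eq x hz.1 t hz.2, hv.interior_eq x hz.1 t hz.2]
      exact congrArg (max (ψ (x, t))) (dppOp_congr (α := α)
        (g := fun y => v (y, t - ε ^ 2 / 2)) (g' := fun y => u (y, t - ε ^ 2 / 2))
        fun y hy => ih y _ (by omega) (mem_extendedCylinder_of_mem_ball hΩ hz hy))
    · rw [hu.boundary_eq _ hb, hv.boundary_eq _ hb]

end Solution

end TugOfWar

namespace TugOfWar

/-! ### The law of the game and optional stopping -/

variable {n N : ℕ} {Ω : Set (E n)} {ε : ℝ} {α : Set.Icc (0 : ℝ) 1}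

/-- The event `τ ≤ k` is a preimage under restriction to the first positions, and freezing a run at
step `k` does not change that restriction. -/
lemma StoppingRule.continues_frestrictLe_iff (τ : StoppingRule Ω ε N) (k : ℕ) (x : ℕ → E n) :
    τ.Continues (Preorder.frestrictLe k x) ↔ k < τ.time x := by
  have h := τ.isStoppingTime k
  rw [Filtration.piLE_eq_comap_frestrictLe] at h
  obtain ⟨B, -, hB⟩ := h
  have hmem : ∀ y : ℕ → E n, τ.time y ≤ k ↔ Preorder.frestrictLe (π := fun _ => E n) k y ∈ B := by
    intro y
    have := Set.ext_iff.1 hB y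
    simp only [Set.mem_preimage, Set.mem_ofPred_eq] at this
    exact WithTop.coe_le_coe.symm.trans this.symm
  have hext : Preorder.frestrictLe (π := fun _ => E n) k
      (History.extend (Preorder.frestrictLe k x)) = Preorder.frestrictLe k x := by
    ext1 i
    simp [History.extend, min_eq_left (Finset.mem_Iic.1 i.2)]
  rw [StoppingRule.Continues, ← not_le, ← not_le, hmem, hmem, hext]

lemma StoppingRule.measurable_time (τ : StoppingRule Ω ε N) : Measurable τ.time := by
  refine measurable_of_Iic fun k => ?_
  have h := (Filtration.piLE (X := fun _ : ℕ => E n)).le k _ (τ.isStoppingTime k)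
  convert h using 1
  ext x
  simp

lemma measurable_apply_nat {Y : Type*} [MeasurableSpace Y] {f : ℕ → (ℕ → E n) → Y}
    (hf : ∀ k, Measurable (f k)) {t : (ℕ → E n) → ℕ} (ht : Measurable t) :
    Measurable fun x => f (t x) x :=
  (measurable_from_prod_countable_right (f := fun p : ℕ × (ℕ → E n) => f p.1 p.2) hf).comp
    (ht.prodMk measurable_id)

instance (τ : StoppingRule Ω ε N) (σI σII : Strategy n ε) (x₀ : E n) :
    IsProbabilityMeasure (gameMeasure α τ σI σII x₀) := by
  unfold gameMeasure
  infer_instance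

variable (τ : StoppingRule Ω ε N) (σI σII : Strategy n ε) (x₀ : E n)

lemma map_gameMeasure_compProd (k : ℕ) :
    (gameMeasure α τ σI σII x₀).map (Preorder.frestrictLe k) ⊗ₘ stepKernel α τ σI σII k =
      (gameMeasure α τ σI σII x₀).map (fun x => (Preorder.frestrictLe k x, x (k + 1))) :=
  Kernel.map_frestrictLe_trajMeasure_compProd_eq_map_trajMeasure (X := fun _ => E n)

lemma ae_gameMeasure_zero_eq : ∀ᵐ x ∂(gameMeasure α τ σI σII x₀), x 0 = x₀ := by
  have hmap : (gameMeasure α τ σI σII x₀).map (Preorder.frestrictLe 0) =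
      (Measure.dirac x₀).map (MeasurableEquiv.piUnique fun _ : Finset.Iic 0 => E n).symm := by
    rw [gameMeasure, Kernel.trajMeasure, Measure.map_comp _ _ (by fun_prop),
      Kernel.traj_map_frestrictLe, Kernel.partialTraj_self, Measure.id_comp]
  have h : ∀ᵐ h ∂((gameMeasure α τ σI σII x₀).map
      (Preorder.frestrictLe (π := fun _ => E n) 0)), History.last h = x₀ := by
    rw [hmap, Measure.map_dirac' (MeasurableEquiv.measurable _)]
    exact (ae_dirac_iff (measurable_last (measurableSet_singleton x₀))).2 rfl
  exact ae_of_ae_map (Preorder.measurable_frestrictLe 0).aemeasurable h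

lemma ae_transition_mem_ball (k : ℕ) (h : History n k) :
    ∀ᵐ y ∂(transition α τ σI σII k h), y ∈ Metric.ball h.last ε := by
  have hε : 0 < ε := Metric.pos_of_mem_ball (σI.move_mem k h)
  have hm : MeasurableSet {y | y ∈ Metric.ball h.last ε} := measurableSet_ball
  rw [transition]
  split_ifs
  · rw [ae_add_measure_iff]
    refine ⟨Measure.ae_smul_measure ?_ _, Measure.ae_smul_measure (ae_cond_ball _) _⟩
    rw [ae_add_measure_iff, ae_dirac_iff hm, ae_dirac_iff hm]
    exact ⟨σI.move_mem k h, σII.move_mem k h⟩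
  · rw [ae_dirac_iff hm]
    exact Metric.mem_ball_self hε

lemma ae_gameMeasure_mem_ball :
    ∀ᵐ x ∂(gameMeasure α τ σI σII x₀), ∀ k, x (k + 1) ∈ Metric.ball (x k) ε := by
  rw [ae_all_iff]
  intro k
  have hp : MeasurableSet {p : History n k × E n | p.2 ∈ Metric.ball p.1.last ε} :=
    measurableSet_lt (measurable_snd.dist (measurable_last.comp measurable_fst)) measurable_const
  have h : ∀ᵐ p ∂((gameMeasure α τ σI σII x₀).map (Preorder.frestrictLe k) ⊗ₘ
      stepKernel α τ σI σII k), p.2 ∈ Metric.ball (History.last p.1) ε :=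
    (Measure.ae_compProd_iff hp).2 <|
      Filter.Eventually.of_forall fun h => ae_transition_mem_ball (α := α) τ σI σII k h
  rw [map_gameMeasure_compProd] at h
  exact ae_of_ae_map ((Preorder.measurable_frestrictLe k).prodMk
    (measurable_pi_apply (k + 1))).aemeasurable h

lemma integral_transition {k : ℕ} {h : History n k} (hc : τ.Continues h) {f : E n → ℝ} {M : ℝ}
    (hf : Measurable f) (hM : ∀ x, |f x| ≤ M) :
    ∫ y, f y ∂(transition α τ σI σII k h) =
      (α : ℝ) / 2 * (f (σI.move k h) + f (σII.move k h)) +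
        (1 - (α : ℝ)) * ⨍ y in Metric.ball h.last ε, f y := by
  have hε : 0 < ε := Metric.pos_of_mem_ball (σI.move_mem k h)
  have := isProbabilityMeasure_cond_ball hε h.last
  have hi : ∀ (μ : Measure (E n)) [IsFiniteMeasure μ], Integrable f μ := fun μ _ =>
    integrable_of_abs_le hf hM
  rw [transition, if_pos hc, integral_add_measure
      ((hi _).smul_measure ENNReal.ofReal_ne_top) ((hi _).smul_measure ENNReal.ofReal_ne_top),
    integral_smul_measure, integral_smul_measure, integral_add_measure (hi _) (hi _),
    integral_dirac, integral_dirac, setAverage_eq_integral_cond,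
    ENNReal.toReal_ofReal (div_nonneg α.2.1 two_pos.le),
    ENNReal.toReal_ofReal (sub_nonneg.2 α.2.2), smul_eq_mul, smul_eq_mul]

variable {τ σI σII x₀}

open Classical in
-- The joint law of history and next position disintegrates along the step kernel, and `k < τ` is
-- decided by the history. This plays the role of conditioning on the first `k` moves.
lemma integral_stopped_increment {v : ℕ → E n → ℝ} {M : ℝ} (hv : ∀ k, Measurable (v k))
    (hM : ∀ k x, |v k x| ≤ M) (k : ℕ) :
    ∫ x, (if k < τ.time x then v (k + 1) (x (k + 1)) - v k (x k) else 0)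
        ∂(gameMeasure α τ σI σII x₀) =
      ∫ x, (if k < τ.time x then
          (∫ y, v (k + 1) y ∂(transition α τ σI σII k (Preorder.frestrictLe k x))) - v k (x k)
        else 0) ∂(gameMeasure α τ σI σII x₀) := by
  have hφ : Measurable fun x : ℕ → E n =>
      (Preorder.frestrictLe (π := fun _ => E n) k x, x (k + 1)) :=
    (Preorder.measurable_frestrictLe k).prodMk (measurable_pi_apply (k + 1))
  let f : History n k × E n → ℝ := fun p =>
    if τ.Continues p.1 then v (k + 1) p.2 - v k p.1.last else 0
  have hf : Measurable f :=
    Measurable.ite (measurable_fst τ.measurableSet_continues)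
      (((hv (k + 1)).comp measurable_snd).sub ((hv k).comp (measurable_last.comp measurable_fst)))
      measurable_const
  have hM0 : 0 ≤ M := (abs_nonneg _).trans (hM 0 0)
  have hfM : ∀ p, |f p| ≤ M + M := by
    intro p
    by_cases hc : τ.Continues p.1
    · simp only [f, if_pos hc]
      exact (abs_sub _ _).trans (add_le_add (hM _ _) (hM _ _))
    · simp only [f, if_neg hc, abs_zero]
      positivity
  have hprob := Measure.isProbabilityMeasure_map (μ := gameMeasure α τ σI σII x₀)
    (Preorder.measurable_frestrictLe k).aemeasurable
  have h1 : ∫ x, (if k < τ.time x then v (k + 1) (x (k + 1)) - v k (x k) else 0)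
      ∂(gameMeasure α τ σI σII x₀) = ∫ p, f p ∂((gameMeasure α τ σI σII x₀).map
        fun x => (Preorder.frestrictLe k x, x (k + 1))) := by
    rw [integral_map hφ.aemeasurable hf.aestronglyMeasurable]
    simp only [f, τ.continues_frestrictLe_iff]
    rfl
  have hmeas : Measurable fun h : History n k => ∫ y, f (h, y) ∂(stepKernel α τ σI σII k h) :=
    (hf.stronglyMeasurable.integral_kernel_prod_right' (κ := stepKernel α τ σI σII k)).measurable
  rw [h1, ← map_gameMeasure_compProd, Measure.integral_compProd (integrable_of_abs_le hf hfM),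
    integral_map (Preorder.measurable_frestrictLe k).aemeasurable hmeas.aestronglyMeasurable]
  refine integral_congr_ae (Filter.Eventually.of_forall fun x => ?_)
  simp only [f, τ.continues_frestrictLe_iff]
  by_cases hk : k < τ.time x
  · simp only [if_pos hk]
    rw [integral_sub (integrable_of_abs_le (hv _) (hM _)) (integrable_const _), integral_const,
      probReal_univ, one_smul]
    rfl
  · simp [hk]

lemma StoppingRule.time_le_rounds (τ : StoppingRule Ω ε N) (x : ℕ → E n) : τ.time x ≤ N :=
  (τ.time_le x).trans (Nat.sInf_le (Or.inl rfl))

/-- Optional stopping for a process that is a supermartingale up to an error `η` per step. -/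
lemma integral_stopped_le {v : ℕ → E n → ℝ} {M η : ℝ} (hv : ∀ k, Measurable (v k))
    (hM : ∀ k x, |v k x| ≤ M) (hη : 0 ≤ η)
    (h : ∀ᵐ x ∂(gameMeasure α τ σI σII x₀), ∀ k < τ.time x,
      ∫ y, v (k + 1) y ∂(transition α τ σI σII k (Preorder.frestrictLe k x)) ≤ v k (x k) + η) :
    ∫ x, v (τ.time x) (x (τ.time x)) ∂(gameMeasure α τ σI σII x₀) ≤ v 0 x₀ + N * η := by
  classical
  set μ := gameMeasure α τ σI σII x₀
  let D : ℕ → (ℕ → E n) → ℝ := fun k x =>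
    if k < τ.time x then v (k + 1) (x (k + 1)) - v k (x k) else 0
  have hD : ∀ k, Measurable (D k) := fun k =>
    Measurable.ite (τ.measurable_time measurableSet_Ioi)
      (((hv (k + 1)).comp (measurable_pi_apply (k + 1))).sub ((hv k).comp (measurable_pi_apply k)))
      measurable_const
  have hM0 : 0 ≤ M := (abs_nonneg _).trans (hM 0 0)
  have hDM : ∀ k x, |D k x| ≤ M + M := by
    intro k x
    by_cases hc : k < τ.time x
    · simp only [D, if_pos hc]
      exact (abs_sub _ _).trans (add_le_add (hM _ _) (hM _ _))
    · simp only [D, if_neg hc, abs_zero]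
      positivity
  -- Telescoping; since `τ ≤ N`, the sum can run over a range that does not depend on the run.
  have hsum : ∀ x, v (τ.time x) (x (τ.time x)) = v 0 (x 0) + ∑ k ∈ Finset.range N, D k x := by
    intro x
    have h1 : ∑ k ∈ Finset.range N, D k x =
        ∑ k ∈ Finset.range (τ.time x), (v (k + 1) (x (k + 1)) - v k (x k)) := by
      rw [← Finset.sum_filter]
      refine Finset.sum_congr ?_ fun _ _ => rfl
      ext k
      have := τ.time_le_rounds x
      simp only [Finset.mem_filter, Finset.mem_range]
      omega
    rw [h1, Finset.sum_range_sub (fun k => v k (x k))]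
    ring
  have hDη : ∀ k, ∫ x, D k x ∂μ ≤ η := by
    intro k
    rw [integral_stopped_increment hv hM k]
    -- Integrability need not be proved: otherwise the integral is `0` by convention, and `0 ≤ η`.
    by_cases hi : Integrable (fun x => if k < τ.time x then
        (∫ y, v (k + 1) y ∂(transition α τ σI σII k (Preorder.frestrictLe k x))) - v k (x k)
      else 0) μ
    · refine (integral_mono_ae hi (integrable_const η) ?_).trans_eq (by simp)
      filter_upwards [h] with x hx
      split_ifs with hk
      · linarith [hx k hk]
      · exact hη
    · rw [integral_undef hi]
      exact hη
  have h0 : ∫ x, v 0 (x 0) ∂μ = v 0 x₀ := by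
    rw [integral_congr_ae (g := fun _ => v 0 x₀)
      ((ae_gameMeasure_zero_eq τ σI σII x₀).mono fun x hx => by simp only [hx])]
    simp
  simp_rw [hsum]
  have h0i : Integrable (fun x : ℕ → E n => v 0 (x 0)) μ :=
    integrable_of_abs_le ((hv 0).comp (measurable_pi_apply 0)) fun x => hM 0 (x 0)
  rw [integral_add h0i
      (integrable_finsetSum _ fun k _ => integrable_of_abs_le (hD k) (hDM k)), h0,
    integral_finsetSum _ fun k _ => integrable_of_abs_le (hD k) (hDM k)]
  gcongr
  refine (Finset.sum_le_card_nsmul _ _ η fun k _ => hDη k).trans_eq ?_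
  simp

end TugOfWar

namespace TugOfWar

/-! ### Almost optimal strategies and the value -/

variable {n N : ℕ} {Ω : Set (E n)} {T ε M : ℝ} {α : Set.Icc (0 : ℝ) 1} {F ψ u : E n × ℝ → ℝ}

/-- The strategy that depends on the time and on the current position only. -/
def Strategy.ofMarkov (s : ℕ → E n → E n) (hs : ∀ k, Measurable (s k))
    (hmem : ∀ k x, s k x ∈ Metric.ball x ε) : Strategy n ε where
  move k h := s k h.last
  measurable_move k := (hs k).comp measurable_last
  move_mem k h := hmem k h.last

lemma measurableSet_piLE_apply_mem {j k : ℕ} (hjk : j ≤ k) {B : Set (E n)} (hB : MeasurableSet B) :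
    MeasurableSet[Filtration.piLE (X := fun _ : ℕ => E n) k] {x | x j ∈ B} := by
  rw [Filtration.piLE_eq_comap_frestrictLe]
  exact ⟨{h | h ⟨j, Finset.mem_Iic.2 hjk⟩ ∈ B}, measurable_pi_apply _ hB, rfl⟩

/-- Player I stops as soon as the position at step `k` lies in `A k`. -/
noncomputable def StoppingRule.hitting (hΩ : IsOpen Ω) (ε : ℝ) (N : ℕ) (A : ℕ → Set (E n))
    (hA : ∀ k, MeasurableSet (A k)) : StoppingRule Ω ε N where
  time x := sInf {k | (k = N ∨ x k ∈ outerStrip Ω ε) ∨ x k ∈ A k}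
  isStoppingTime k := by
    have h : {x : ℕ → E n | ((sInf {k | (k = N ∨ x k ∈ outerStrip Ω ε) ∨ x k ∈ A k} : ℕ) :
        WithTop ℕ) ≤ (k : ℕ)} = ⋃ j ∈ Set.Iic k,
          ({x | j = N} ∪ {x | x j ∈ outerStrip Ω ε}) ∪ {x | x j ∈ A j} := by
      ext x
      have hne : {k | (k = N ∨ x k ∈ outerStrip Ω ε) ∨ x k ∈ A k}.Nonempty :=
        ⟨N, Or.inl (Or.inl rfl)⟩
      simp only [Set.mem_iUnion, exists_prop]
      refine WithTop.coe_le_coe.trans ⟨fun h => ⟨_, h, Nat.sInf_mem hne⟩, ?_⟩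
      rintro ⟨j, hj, h⟩
      exact (Nat.sInf_le (s := {k | (k = N ∨ x k ∈ outerStrip Ω ε) ∨ x k ∈ A k}) h).trans hj
    refine (congrArg (MeasurableSet[Filtration.piLE (X := fun _ : ℕ => E n) k]) h).mpr ?_
    refine MeasurableSet.biUnion (Set.to_countable _) fun j hj => ?_
    exact ((MeasurableSet.const _).union
      (measurableSet_piLE_apply_mem hj (isClosed_outerStrip hΩ).measurableSet)).union
      (measurableSet_piLE_apply_mem hj (hA j))
  time_le x := Nat.sInf_le (Or.inl (Nat.sInf_mem (s := {k | k = N ∨ x k ∈ outerStrip Ω ε})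
    ⟨N, Or.inl rfl⟩))

/-- As long as the game lasts, the token and its time stay in the extended cylinder. -/
lemma mem_extendedCylinder_of_le_maxLength (hΩ : IsOpen Ω) (hε : 0 < ε) {z : E n × ℝ}
    (hz : z ∈ extendedCylinder Ω T ε) {x : ℕ → E n} (h0 : x 0 = z.1)
    (hx : ∀ k, x (k + 1) ∈ Metric.ball (x k) ε) (k : ℕ) :
    (k ≤ maxLength Ω ε (rounds ε z.2) x →
      (x k, z.2 - k * (ε ^ 2 / 2)) ∈ extendedCylinder Ω T ε) ∧
    (k < maxLength Ω ε (rounds ε z.2) x → (x k, z.2 - k * (ε ^ 2 / 2)) ∈ cylinder Ω T) := by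
  have hstep : ∀ k, (x k, z.2 - k * (ε ^ 2 / 2)) ∈ extendedCylinder Ω T ε →
      k < maxLength Ω ε (rounds ε z.2) x → (x k, z.2 - k * (ε ^ 2 / 2)) ∈ cylinder Ω T := by
    intro k hk hlt
    -- Before the maximal length the token is off the outer strip and the time is still positive,
    -- which excludes both pieces of the boundary strip.
    have hnot : k ∉ {k | k = rounds ε z.2 ∨ x k ∈ outerStrip Ω ε} := Nat.notMem_of_lt_sInf hlt
    have hkN : k < rounds ε z.2 := hlt.trans_le (Nat.sInf_le (Or.inl rfl))
    refine hk.resolve_right fun h => ?_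
    rcases h with h | h
    · exact hnot (Or.inr h.1)
    · exact absurd (sub_mul_pos_of_lt_rounds hε hkN) (not_lt.2 h.2.2)
  suffices h : k ≤ maxLength Ω ε (rounds ε z.2) x →
      (x k, z.2 - k * (ε ^ 2 / 2)) ∈ extendedCylinder Ω T ε from
    ⟨h, fun hk => hstep k (h hk.le) hk⟩
  induction k with
  | zero =>
    intro _
    simpa [h0] using hz
  | succ k ih =>
    intro hk
    have := mem_extendedCylinder_of_mem_ball hΩ
      (hstep k (ih (Nat.le_of_succ_le hk)) hk) (hx k)
    convert this using 2
    push_cast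
    ring

lemma ae_mem_extendedCylinder (hΩ : IsOpen Ω) (hε : 0 < ε) {z : E n × ℝ}
    (hz : z ∈ extendedCylinder Ω T ε) (τ : StoppingRule Ω ε (rounds ε z.2))
    (σI σII : Strategy n ε) :
    ∀ᵐ x ∂(gameMeasure α τ σI σII z.1),
      (x (τ.time x), z.2 - τ.time x * (ε ^ 2 / 2)) ∈ extendedCylinder Ω T ε ∧
      ∀ k < τ.time x, (x k, z.2 - k * (ε ^ 2 / 2)) ∈ cylinder Ω T := by
  filter_upwards [ae_gameMeasure_zero_eq τ σI σII z.1, ae_gameMeasure_mem_ball τ σI σII z.1]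
    with x h0 hx
  exact ⟨(mem_extendedCylinder_of_le_maxLength hΩ hε hz h0 hx _).1 (τ.time_le x), fun k hk =>
    (mem_extendedCylinder_of_le_maxLength hΩ hε hz h0 hx k).2 (hk.trans_le (τ.time_le x))⟩

lemma payoff_of_mem_boundaryStrip {z : E n × ℝ} (hz : z ∈ boundaryStrip Ω T ε) :
    payoff Ω T ε F ψ z = F z :=
  if_pos hz

lemma payoff_of_mem_cylinder {z : E n × ℝ} (hz : z ∈ cylinder Ω T) :
    payoff Ω T ε F ψ z = ψ z :=
  if_neg (notMem_boundaryStrip_of_mem_cylinder hz)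

lemma measurable_payoff (hΩ : IsOpen Ω) (hF : ContinuousOn F (boundaryStrip Ω T ε))
    (hψ : Continuous ψ) : Measurable (payoff Ω T ε F ψ) := by
  classical
  have h : payoff Ω T ε F ψ = (boundaryStrip Ω T ε).piecewise F ψ := by
    ext z
    by_cases hz : z ∈ boundaryStrip Ω T ε <;> simp [payoff, hz]
  rw [h]
  exact hF.measurable_piecewise hψ.continuousOn (measurableSet_boundaryStrip hΩ)

/-- The obstacle is bounded only on the cylinder, so the bound holds almost surely, along runs that
respect the step size. -/
lemma integrable_payoff (hΩ : IsOpen Ω) (hε : 0 < ε) (hF : ContinuousOn F (boundaryStrip Ω T ε))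
    (hψ : Continuous ψ) (hFM : ∀ z ∈ boundaryStrip Ω T ε, |F z| ≤ M)
    (hψM : ∀ z ∈ cylinder Ω T, |ψ z| ≤ M) {z : E n × ℝ} (hz : z ∈ extendedCylinder Ω T ε)
    (τ : StoppingRule Ω ε (rounds ε z.2)) (σI σII : Strategy n ε) :
    Integrable (fun x => payoff Ω T ε F ψ (x (τ.time x), z.2 - τ.time x * (ε ^ 2 / 2)))
      (gameMeasure α τ σI σII z.1) := by
  refine Integrable.of_bound (C := M) (measurable_apply_nat
    (f := fun k x => payoff Ω T ε F ψ (x k, z.2 - k * (ε ^ 2 / 2))) (fun k => ?_)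
    τ.measurable_time).aestronglyMeasurable ?_
  · exact (measurable_payoff hΩ hF hψ).comp ((measurable_pi_apply k).prodMk measurable_const)
  · filter_upwards [ae_mem_extendedCylinder hΩ hε hz τ σI σII] with x hx
    rcases hx.1 with h | h
    · rw [payoff_of_mem_cylinder h]; exact hψM _ h
    · rw [payoff_of_mem_boundaryStrip h]; exact hFM _ h

lemma integrable_stopped (hu : ∀ t, Measurable fun x => u (x, t)) (huM : ∀ z, |u z| ≤ M)
    {z : E n × ℝ} (τ : StoppingRule Ω ε N) (σI σII : Strategy n ε) :
    Integrable (fun x => u (x (τ.time x), z.2 - τ.time x * (ε ^ 2 / 2)))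
      (gameMeasure α τ σI σII z.1) :=
  integrable_of_abs_le (measurable_apply_nat
    (f := fun k x => u (x k, z.2 - k * (ε ^ 2 / 2)))
    (fun k => (hu _).comp (measurable_pi_apply k)) τ.measurable_time) fun _ => huM _

lemma IsDPPSolution.payoff_le (hu : IsDPPSolution Ω T ε α F ψ u) {z : E n × ℝ}
    (hz : z ∈ extendedCylinder Ω T ε) : payoff Ω T ε F ψ z ≤ u z := by
  rcases hz with h | h
  · rw [payoff_of_mem_cylinder h, ← Prod.mk.eta (p := z), hu.interior_eq z.1 h.1 z.2 h.2]
    exact le_max_left _ _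
  · rw [payoff_of_mem_boundaryStrip h, hu.boundary_eq z h]

lemma IsDPPSolution.eq_max_dppOp (hu : IsDPPSolution Ω T ε α F ψ u) {x : E n} {t : ℝ} {k : ℕ}
    (h : (x, t - k * (ε ^ 2 / 2)) ∈ cylinder Ω T) :
    u (x, t - k * (ε ^ 2 / 2)) = max (ψ (x, t - k * (ε ^ 2 / 2)))
      (dppOp α ε (fun y => u (y, t - (k + 1 : ℕ) * (ε ^ 2 / 2))) x) := by
  have ht : t - (k + 1 : ℕ) * (ε ^ 2 / 2) = t - k * (ε ^ 2 / 2) - ε ^ 2 / 2 := by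
    push_cast
    ring
  rw [hu.interior_eq x h.1 _ h.2, ht]
  rfl

lemma le_iSup_ball {g : E n → ℝ} (hg : ∀ x, |g x| ≤ M) {x y : E n} (hy : y ∈ Metric.ball x ε) :
    g y ≤ ⨆ y : Metric.ball x ε, g y :=
  le_ciSup (f := fun y : Metric.ball x ε => g y) (bddAbove_of_abs_le fun y => hg y) ⟨y, hy⟩

lemma iInf_ball_le {g : E n → ℝ} (hg : ∀ x, |g x| ≤ M) {x y : E n} (hy : y ∈ Metric.ball x ε) :
    ⨅ y : Metric.ball x ε, g y ≤ g y :=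
  ciInf_le (f := fun y : Metric.ball x ε => g y) (bddBelow_of_abs_le fun y => hg y) ⟨y, hy⟩

lemma exists_strategyII_expectedPayoff_le (hΩ : IsOpen Ω) (hε : 0 < ε)
    (hF : ContinuousOn F (boundaryStrip Ω T ε))
    (hψ : Continuous ψ) (hFM : ∀ z ∈ boundaryStrip Ω T ε, |F z| ≤ M)
    (hψM : ∀ z ∈ cylinder Ω T, |ψ z| ≤ M) (hu : IsDPPSolution Ω T ε α F ψ u)
    (hum : ∀ t, Measurable fun x => u (x, t)) (huM : ∀ z, |u z| ≤ M) {z : E n × ℝ}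
    (hz : z ∈ extendedCylinder Ω T ε) {η : ℝ} (hη : 0 < η) :
    ∃ σII : Strategy n ε, ∀ (τ : StoppingRule Ω ε (rounds ε z.2)) (σI : Strategy n ε),
      expectedPayoff T α F ψ z τ σI σII ≤ u z + rounds ε z.2 * η := by
  let v : ℕ → E n → ℝ := fun k x => u (x, z.2 - k * (ε ^ 2 / 2))
  have hv : ∀ k, Measurable (v k) := fun k => hum _
  have hvM : ∀ k x, |v k x| ≤ M := fun k x => huM _
  choose s hs hsmem using fun k =>
    exists_measurable_le_iInf_add (bddBelow_of_abs_le (hvM (k + 1))) hε hη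
  refine ⟨Strategy.ofMarkov s hs fun k x => (hsmem k x).1, fun τ σI => ?_⟩
  set σII := Strategy.ofMarkov s hs fun k x => (hsmem k x).1
  have key := integral_stopped_le (τ := τ) (σI := σI) (σII := σII) (α := α) (x₀ := z.1) hv hvM
    hη.le ?_
  · have h0 : v 0 z.1 = u z := by simp [v]
    rw [← h0]
    refine le_trans (integral_mono_ae (integrable_payoff hΩ hε hF hψ hFM hψM hz τ σI σII)
      (integrable_stopped hum huM τ σI σII) ?_) key
    filter_upwards [ae_mem_extendedCylinder hΩ hε hz τ σI σII] with x hx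
    exact hu.payoff_le hx.1
  · filter_upwards [ae_mem_extendedCylinder hΩ hε hz τ σI σII] with x hx k hk
    have hc : τ.Continues (Preorder.frestrictLe k x) := (τ.continues_frestrictLe_iff k x).2 hk
    rw [integral_transition τ σI σII hc (hv (k + 1)) (hvM (k + 1))]
    have h1 : v (k + 1) (σI.move k (Preorder.frestrictLe k x)) ≤
        ⨆ y : Metric.ball (x k) ε, v (k + 1) y :=
      le_iSup_ball (hvM (k + 1)) (σI.move_mem k (Preorder.frestrictLe k x))
    have h2 : v (k + 1) (σII.move k (Preorder.frestrictLe k x)) ≤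
        (⨅ y : Metric.ball (x k) ε, v (k + 1) y) + η := (hsmem k (x k)).2
    have h3 : dppOp α ε (v (k + 1)) (x k) ≤ v k (x k) :=
      (le_max_right _ _).trans_eq (hu.eq_max_dppOp (hx.2 k hk)).symm
    have h4 := mul_le_mul_of_nonneg_left (add_le_add h1 h2)
      (div_nonneg α.2.1 two_pos.le : 0 ≤ (α : ℝ) / 2)
    -- Only player II's own move, of weight `α/2`, is suboptimal; the per-step error is thus at most
    -- `η`.
    have h5 : (α : ℝ) / 2 * η ≤ 1 * η :=
      mul_le_mul_of_nonneg_right (by linarith [α.2.2]) hη.le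
    have h6 : History.last (Preorder.frestrictLe (π := fun _ => E n) k x) = x k := rfl
    rw [dppOp] at h3
    rw [h6]
    linarith

lemma exists_strategyI_le_expectedPayoff (hΩ : IsOpen Ω) (hε : 0 < ε)
    (hF : ContinuousOn F (boundaryStrip Ω T ε))
    (hψ : Continuous ψ) (hFM : ∀ z ∈ boundaryStrip Ω T ε, |F z| ≤ M)
    (hψM : ∀ z ∈ cylinder Ω T, |ψ z| ≤ M) (hu : IsDPPSolution Ω T ε α F ψ u)
    (hum : ∀ t, Measurable fun x => u (x, t)) (huM : ∀ z, |u z| ≤ M) {z : E n × ℝ}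
    (hz : z ∈ extendedCylinder Ω T ε) {η : ℝ} (hη : 0 < η) :
    ∃ (τ : StoppingRule Ω ε (rounds ε z.2)) (σI : Strategy n ε), ∀ σII : Strategy n ε,
      u z - rounds ε z.2 * η ≤ expectedPayoff T α F ψ z τ σI σII := by
  let v : ℕ → E n → ℝ := fun k x => u (x, z.2 - k * (ε ^ 2 / 2))
  have hv : ∀ k, Measurable (v k) := fun k => hum _
  have hvM : ∀ k x, |v k x| ≤ M := fun k x => huM _
  choose s hs hsmem using fun k =>
    exists_measurable_iSup_sub_le (bddAbove_of_abs_le (hvM (k + 1))) hε hη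
  -- The contact set with the obstacle, where stopping costs player I nothing.
  let A : ℕ → Set (E n) := fun k => {x | v k x ≤ ψ (x, z.2 - k * (ε ^ 2 / 2))}
  have hA : ∀ k, MeasurableSet (A k) := fun k =>
    measurableSet_le (hv k) (hψ.measurable.comp measurable_prodMk_right)
  let τ : StoppingRule Ω ε (rounds ε z.2) := StoppingRule.hitting hΩ ε (rounds ε z.2) A hA
  let σI : Strategy n ε := Strategy.ofMarkov s hs fun k x => (hsmem k x).1
  refine ⟨τ, σI, fun σII => ?_⟩
  -- Applied to `-v`, so that the supermartingale estimate becomes a lower bound.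
  have key := integral_stopped_le (τ := τ) (σI := σI) (σII := σII) (α := α) (x₀ := z.1)
    (v := fun k x => -v k x) (fun k => (hv k).neg) (fun k x => (abs_neg _).trans_le (hvM k x))
    hη.le ?_
  · have h0 : v 0 z.1 = u z := by simp [v]
    rw [integral_neg, h0] at key
    refine le_trans (show u z - rounds ε z.2 * η ≤ _ by linarith) (integral_mono_ae
      (integrable_stopped hum huM τ σI σII)
      (integrable_payoff hΩ hε hF hψ hFM hψM hz τ σI σII) ?_)
    filter_upwards [ae_mem_extendedCylinder hΩ hε hz τ σI σII] with x hx
    rcases hx.1 with h | h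
    · rw [payoff_of_mem_cylinder h]
      have hmem : τ.time x ∈ {k | (k = rounds ε z.2 ∨ x k ∈ outerStrip Ω ε) ∨ x k ∈ A k} :=
        Nat.sInf_mem ⟨rounds ε z.2, Or.inl (Or.inl rfl)⟩
      -- Stopping inside the cylinder can only be due to contact: after all rounds the time is
      -- nonpositive, and the outer strip is disjoint from `Ω`.
      rcases hmem with (hN | hS) | hmem
      · have hpos := h.2.1
        simp only [hN] at hpos
        exact absurd hpos (not_lt.2 (sub_rounds_mul_nonpos hε))
      · exact absurd h.1 hS.1
      · exact hmem
    · rw [payoff_of_mem_boundaryStrip h, hu.boundary_eq _ h]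
  · filter_upwards [ae_mem_extendedCylinder hΩ hε hz τ σI σII] with x hx k hk
    have hc : τ.Continues (Preorder.frestrictLe k x) := (τ.continues_frestrictLe_iff k x).2 hk
    rw [integral_neg, integral_transition τ σI σII hc (hv (k + 1)) (hvM (k + 1))]
    have h1 : (⨆ y : Metric.ball (x k) ε, v (k + 1) y) - η ≤
        v (k + 1) (σI.move k (Preorder.frestrictLe k x)) := (hsmem k (x k)).2
    have h2 : ⨅ y : Metric.ball (x k) ε, v (k + 1) y ≤
        v (k + 1) (σII.move k (Preorder.frestrictLe k x)) :=
      iInf_ball_le (hvM (k + 1)) (σII.move_mem k (Preorder.frestrictLe k x))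
    have hnot : x k ∉ A k := fun h =>
      Nat.notMem_of_lt_sInf (s := {k | (k = rounds ε z.2 ∨ x k ∈ outerStrip Ω ε) ∨ x k ∈ A k}) hk
        (Or.inr h)
    have h3 : v k (x k) ≤ dppOp α ε (v (k + 1)) (x k) :=
      (le_max_iff.1 (hu.eq_max_dppOp (hx.2 k hk)).le).resolve_left hnot
    have h4 := mul_le_mul_of_nonneg_left (add_le_add h1 h2)
      (div_nonneg α.2.1 two_pos.le : 0 ≤ (α : ℝ) / 2)
    have h5 : (α : ℝ) / 2 * η ≤ 1 * η :=
      mul_le_mul_of_nonneg_right (by linarith [α.2.2]) hη.le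
    have h6 : History.last (Preorder.frestrictLe (π := fun _ => E n) k x) = x k := rfl
    rw [dppOp] at h3
    rw [h6]
    linarith

lemma valueI_le_valueII (z : E n × ℝ) : valueI Ω T ε α F ψ z ≤ valueII Ω T ε α F ψ z := by
  refine iSup₂_le fun τ σI => le_iInf fun σII => iInf_le_of_le σII ?_
  exact le_iSup₂ (f := fun (τ : StoppingRule Ω ε (rounds ε z.2)) (σI : Strategy n ε) =>
    ((expectedPayoff T α F ψ z τ σI σII : ℝ) : EReal)) τ σI

lemma exists_pos_mul_lt (N : ℕ) {δ : ℝ} (hδ : 0 < δ) : ∃ η : ℝ, 0 < η ∧ N * η < δ := by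
  refine ⟨δ / (N + 1), by positivity, ?_⟩
  rw [← mul_div_assoc, div_lt_iff₀ (by positivity)]
  nlinarith

/-- `hum` and `huM` concern all of space because strategies must be Borel at every position, even
those no run reaches. The extension of the solution by zero satisfies both. -/
theorem IsDPPSolution.value_eq (hΩ : IsOpen Ω) (hε : 0 < ε)
    (hF : ContinuousOn F (boundaryStrip Ω T ε))
    (hψ : Continuous ψ) (hFM : ∀ z ∈ boundaryStrip Ω T ε, |F z| ≤ M)
    (hψM : ∀ z ∈ cylinder Ω T, |ψ z| ≤ M) (hu : IsDPPSolution Ω T ε α F ψ u)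
    (hum : ∀ t, Measurable fun x => u (x, t)) (huM : ∀ z, |u z| ≤ M) {z : E n × ℝ}
    (hz : z ∈ extendedCylinder Ω T ε) :
    valueI Ω T ε α F ψ z = ((u z : ℝ) : EReal) ∧ valueII Ω T ε α F ψ z = ((u z : ℝ) : EReal) := by
  have hII : valueII Ω T ε α F ψ z ≤ ((u z : ℝ) : EReal) := by
    refine le_of_forall_gt fun c hc => ?_
    obtain ⟨r, hr1, hr2⟩ := EReal.lt_iff_exists_real_btwn.1 hc
    obtain ⟨η, hη, hηr⟩ :=
      exists_pos_mul_lt (rounds ε z.2) (sub_pos.2 (EReal.coe_lt_coe_iff.1 hr1))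
    obtain ⟨σII, h⟩ := exists_strategyII_expectedPayoff_le hΩ hε hF hψ hFM hψM hu hum huM hz hη
    refine (iInf_le_of_le σII (iSup₂_le fun τ σI => EReal.coe_le_coe_iff.2 ?_)).trans_lt hr2
    linarith [h τ σI]
  have hI : ((u z : ℝ) : EReal) ≤ valueI Ω T ε α F ψ z := by
    refine le_of_forall_lt fun c hc => ?_
    obtain ⟨r, hr1, hr2⟩ := EReal.lt_iff_exists_real_btwn.1 hc
    obtain ⟨η, hη, hηr⟩ :=
      exists_pos_mul_lt (rounds ε z.2) (sub_pos.2 (EReal.coe_lt_coe_iff.1 hr2))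
    obtain ⟨τ, σI, h⟩ := exists_strategyI_le_expectedPayoff hΩ hε hF hψ hFM hψM hu hum huM hz hη
    refine hr1.trans_le ((le_iInf fun σII => EReal.coe_le_coe_iff.2 ?_).trans
      (le_iSup₂ (f := fun (τ : StoppingRule Ω ε (rounds ε z.2)) (σI : Strategy n ε) =>
        ⨅ σII : Strategy n ε, ((expectedPayoff T α F ψ z τ σI σII : ℝ) : EReal)) τ σI))
    linarith [h σII]
  exact ⟨((valueI_le_valueII z).trans hII).antisymm hI,
    hII.antisymm (hI.trans (valueI_le_valueII z))⟩

end TugOfWar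

theorem theorem3p3 (n : ℕ) (Ω : Set (TugOfWar.E n)) (hΩ_open : IsOpen Ω)
    (hΩ_conn : IsConnected Ω) (hΩ_bdd : Bornology.IsBounded Ω)
    (T ε : ℝ) (hT : 0 < T) (hε : 0 < ε) (α : Set.Icc (0 : ℝ) 1)
    (F ψ : TugOfWar.E n × ℝ → ℝ) (C₁ C₂ : ℝ)
    (hF : TugOfWar.ParabolicLipschitzOn C₁ F (TugOfWar.boundaryStrip Ω T ε))
    (hψ : TugOfWar.ParabolicLipschitzOn C₂ ψ Set.univ)
    (hψF : ∀ z ∈ TugOfWar.boundaryStrip Ω T ε, ψ z ≤ F z) :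
    ∃ u : TugOfWar.E n × ℝ → ℝ,
      TugOfWar.IsDPPSolution Ω T ε α F ψ u ∧
      (∀ v : TugOfWar.E n × ℝ → ℝ, TugOfWar.IsDPPSolution Ω T ε α F ψ v →
        Set.EqOn v u (TugOfWar.extendedCylinder Ω T ε)) ∧
      ∀ z ∈ TugOfWar.extendedCylinder Ω T ε,
        TugOfWar.valueI Ω T ε α F ψ z = ((u z : ℝ) : EReal) ∧
        TugOfWar.valueII Ω T ε α F ψ z = ((u z : ℝ) : EReal) := by
  have hψ' : TugOfWar.ParabolicLipschitzOn C₂ ψ (TugOfWar.cylinder Ω T) :=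
    fun z _ w _ => hψ z trivial w trivial
  obtain ⟨M₁, hM₁⟩ :=
    hF.exists_abs_le (TugOfWar.isBounded_boundaryStrip hΩ_conn.nonempty hΩ_bdd)
  obtain ⟨M₂, hM₂⟩ := hψ'.exists_abs_le (hΩ_bdd.prod (Metric.isBounded_Ioo 0 T))
  -- Including `0` makes the bound valid for the extension by zero as well.
  set M := max 0 (max M₁ M₂)
  have hM : 0 ≤ M := le_max_left _ _
  have hFM : ∀ z ∈ TugOfWar.boundaryStrip Ω T ε, |F z| ≤ M := fun z hz =>
    (hM₁ z hz).trans ((le_max_left _ _).trans (le_max_right _ _))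
  have hψM : ∀ z ∈ TugOfWar.cylinder Ω T, |ψ z| ≤ M := fun z hz =>
    (hM₂ z hz).trans ((le_max_right _ _).trans (le_max_right _ _))
  have hψc : Continuous ψ := continuousOn_univ.1 hψ.continuousOn
  have hu := TugOfWar.isDPPSolution_dppSolution (α := α) hΩ_open hε hF hψ hM hFM hψM
  refine ⟨_, hu, fun v hv => hu.eqOn hΩ_open hε hv, fun z hz =>
    hu.value_eq hΩ_open hε hF.continuousOn hψc hFM hψM (fun t => ?_) (fun w => ?_) hz⟩
  · exact (TugOfWar.measurable_dppSolution hΩ_open hε hF hψ hM hFM hψM).comp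
      measurable_prodMk_right
  · exact (TugOfWar.dppIter_measurable_and_abs_le hΩ_open hε hF.continuousOn hψc hM hFM hψM
      _ _).2 _
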